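/- Let $f:(0,\infty)\to\mathbb{R}$ be a $C^1$ function. For a real $C^1$ function $g$ on $(0,\infty)$ and $t_1,\dots,t_n\in(0,\infty)$ (not necessarily distinct), let $L_g(t_1,\dots,t_n)$ be the $n\times n$ matrix whose $(i,j)$ entry is $\frac{g(t_i)-g(t_j)}{t_i-t_j}$ if $t_i\neq t_j$ and $g'(t_i)$ if $t_i=t_j$. A Hermitian matrix $A\in M_n(\mathbb{C})$ is called conditionally positive definite if $\langle x,Ax\rangle\ge 0$ for all $x\in\mathbb{C}^n$ with $\sum_{i=1}^n x_i=0$, and conditionally negative definite if $-A$ is conditionally positive definite. For each integer $n\ge 1$ consider the following conditions. (a)$_n$ $f$ is $n$-convex on $(0,\infty)$, i.e. $f(\lambda A+(1-\lambda)B)\le\lambda f(A)+(1-\lambda)f(B)$ for all Hermitian $A,B\in M_n(\mathbb{C})$ with all eigenvalues in $(0,\infty)$ and all $\lambda\in(0,1)$, where $\le$ is the order given by positive semidefiniteness. (b)$_n$ $\liminf_{t\to\infty} f(t)/t>-\infty$, and $L_f(t_1,\dots,t_n)$ is conditionally negative definite for all $t_1,\dots,t_n\in(0,\infty)$. (c)$_n$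 $\limsup_{t\searrow 0} t f(t)\ge 0$, and $L_{tf(t)}(t_1,\dots,t_n)$, the matrix $L_g(t_1,\dots,t_n)$ for $g(t)=tf(t)$, is conditionally positive definite for all $t_1,\dots,t_n\in(0,\infty)$. The lower and upper limits are taken in $[-\infty,\infty]$. Then for every integer $n\ge 1$ the following implications hold: (a)$_{2n+1}\Rightarrow$ (b)$_n$, (b)$_{4n+1}\Rightarrow$ (a)$_n$, (a)$_{n+1}\Rightarrow$ (c)$_n$, and (c)$_{2n+1}\Rightarrow$ (a)$_n$. -/

import Mathlib

open Filter Topology Matrix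
open scoped ComplexOrder

noncomputable section

/-- `f` is matrix convex of order `n` (`n`-convex) on `J`:
`f(λA + (1-λ)B) ≤ λ f(A) + (1-λ) f(B)` in the Loewner order, for all complex Hermitian `n × n`
matrices `A`, `B` with spectrum in `J` and all `λ ∈ (0,1)`. Here `f(A)` is `cfc f A`, the
functional calculus of the Hermitian matrix `A`. -/
def MatrixConvexOn (n : ℕ) (J : Set ℝ) (f : ℝ → ℝ) : Prop :=
  ∀ A B : Matrix (Fin n) (Fin n) ℂ, A.IsHermitian → B.IsHermitian →
    spectrum ℝ A ⊆ J → spectrum ℝ B ⊆ J →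
    ∀ l : ℝ, 0 < l → l < 1 →
      (l • cfc f A + (1 - l) • cfc f B - cfc f (l • A + (1 - l) • B)).PosSemidef

/-- A Hermitian matrix `A` is conditionally positive definite: `⟨x, A x⟩ ≥ 0` for all complex
vectors `x` whose coordinates sum to zero (the quadratic form is real, as `A` is Hermitian). -/
def CondPosDef {n : ℕ} (A : Matrix (Fin n) (Fin n) ℂ) : Prop :=
  A.IsHermitian ∧ ∀ x : Fin n → ℂ, ∑ i, x i = 0 → 0 ≤ (star x ⬝ᵥ (A *ᵥ x)).re

/-- Conditionally negative definite: `-A` is conditionally positive definite. -/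
def CondNegDef {n : ℕ} (A : Matrix (Fin n) (Fin n) ℂ) : Prop :=
  CondPosDef (-A)

open Classical in
/-- The first divided difference of `f`, with the value `f'(s)` on the diagonal. -/
def divDiff (f : ℝ → ℝ) (s t : ℝ) : ℝ :=
  if s = t then deriv f s else (f s - f t) / (s - t)

/-- The Loewner matrix of `f` at `t₁, …, tₙ` (not necessarily distinct). -/
def loewnerMatrix (f : ℝ → ℝ) {n : ℕ} (t : Fin n → ℝ) : Matrix (Fin n) (Fin n) ℂ :=
  Matrix.of fun i j => ((divDiff f (t i) (t j) : ℝ) : ℂ)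

/-- `f` is `n`-convex on `(0,∞)`. -/
def CondA (n : ℕ) (f : ℝ → ℝ) : Prop :=
  MatrixConvexOn n (Set.Ioi 0) f

/-- `liminf_{t → ∞} f(t)/t > -∞` (the lower limit taken in the extended reals) and all `n`-point
Loewner matrices of `f` on `(0,∞)` are conditionally negative definite. -/
def CondB (n : ℕ) (f : ℝ → ℝ) : Prop :=
  (⊥ : EReal) < liminf (fun t : ℝ => ((f t / t : ℝ) : EReal)) atTop ∧
    ∀ t : Fin n → ℝ, (∀ i, 0 < t i) → CondNegDef (loewnerMatrix f t)

/-- `limsup_{t ↘ 0} t f(t) ≥ 0` (the upper limit taken in the extended reals) and all `n`-point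
Loewner matrices of `t ↦ t f(t)` on `(0,∞)` are conditionally positive definite. -/
def CondC (n : ℕ) (f : ℝ → ℝ) : Prop :=
  (0 : EReal) ≤ limsup (fun t : ℝ => ((t * f t : ℝ) : EReal)) (𝓝[>] (0 : ℝ)) ∧
    ∀ t : Fin n → ℝ, (∀ i, 0 < t i) → CondPosDef (loewnerMatrix (fun s => s * f s) t)

end

/-!
The four implications rest on one first-order fact. If `A(τ)` is a differentiable path of Hermitian
matrices and `A(τ₀)` has eigenvectors `uᵢ` with eigenvalues `tᵢ`, then for `ζ = ∑ zᵢ uᵢ`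
`d/dτ ⟨ζ, f(A(τ)) ζ⟩ = ∑ᵢⱼ z̄ᵢ zⱼ f[tᵢ, tⱼ] ⟨uᵢ, A'(τ₀) uⱼ⟩` at `τ₀`
(`hasDerivAt_quadForm_cfc`), where `f[s, t]` is the first divided difference. It only needs `f` to
be differentiable, because of the exact identity `r f(A) - f(t) r = r (A - A₀) g(A)`, `g = f[t, ·]`,
valid for every left eigenvector `r` of `A₀` with eigenvalue `t` (`vecMul_cfc_sub`).

**From Loewner matrices to convexity.** By the usual `2 × 2` block argument, `n`-convexity follows
from `f(V* X V) ≤ V* f(X) V` for `X` positive definite of size `2n` and `V` an isometry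
(`condA_of_compression`). Let `Q = 1 - VV*` and let `ζ` be in the range of `V`, so that `Qζ = 0`.

* If the matrices `f[tᵢ, tⱼ]` are conditionally negative definite, `⟨ζ, f(X + τQ) ζ⟩` decreases in
  `τ ≥ 0`: its derivative is `∑ z̄ᵢ zⱼ f[tᵢ, tⱼ] ⟨Quᵢ, Quⱼ⟩`, a sum over the coordinates `a` of
  quadratic forms in the vectors `(zⱼ (Quⱼ)ₐ)ⱼ`, and these have sum `(Qζ)ₐ = 0`. As `τ → ∞`, the
  inverse of `X + τQ` tends to `V (V* X V)⁻¹ V*`.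
* If the Loewner matrices of `g(t) = t f(t)` are conditionally positive definite, the same
  argument along `S X S`, `S = 1 - Q + σQ`, shows that the form increases in `σ > 0`, since
  `(s + t) f[s, t] = 2 g[s, t] - f(s) - f(t)` and the last two terms contribute nothing. As `σ → 0`,
  `S X S` tends to `V (V* X V) V*`.

In both cases part of the spectrum escapes to an end of `(0, ∞)`, and the condition on the lower or
upper limit, used after adding `-ct` or `ε/t` to `f`, makes `f ≥ 0` there, so that the escaping part
can be cut off (`quadForm_cfc_le_of_tendsto`).

**From convexity to Loewner matrices.** Conjugating by the reflection `2VV* - 1` shows that an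
`(n+1)`-convex `f` satisfies `f(V* D V) ≤ V* f(D) V` for `D = diag(s, t₁, …, tₙ)` and isometries `V`
from `ℂⁿ`. Differentiating at the trivial isometry along `tiltedIsometry` gives
`∑ x̄ᵢ xⱼ (2 f(s) - f(tᵢ) - f(tⱼ) - (2s - tᵢ - tⱼ) f[tᵢ, tⱼ]) ≥ 0` (`CondA.sum_kernel_nonneg`).
If `∑ xᵢ = 0`, this says `∑ x̄ᵢ xⱼ (g[tᵢ, tⱼ] - s f[tᵢ, tⱼ]) ≥ 0` for all `s > 0`; letting `s → ∞`
and `s → 0` yields both Loewner conditions. A single point gives the tangent line inequality, hence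
the two conditions at the ends of `(0, ∞)`.
-/

/-! ### Functional calculus of Hermitian matrices -/

section FunctionalCalculus

variable {ι κ : Type*} [Fintype ι] [DecidableEq ι] [Fintype κ]

/-- The spectrum of a matrix is finite, so every function is continuous on it. -/
lemma continuousOn_spectrum_matrix {A : Matrix ι ι ℂ} (f : ℝ → ℝ) :
    ContinuousOn f (spectrum ℝ A) :=
  A.finite_real_spectrum.continuousOn f

/-- On two given matrices the functional calculus agrees with evaluation of a polynomial,
namely an interpolation polynomial on the union of the spectra. -/
lemma exists_polynomial_cfc_eq [DecidableEq κ] {A : Matrix ι ι ℂ} {B : Matrix κ κ ℂ}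
    (hA : A.IsHermitian) (hB : B.IsHermitian) (f : ℝ → ℝ) :
    ∃ p : Polynomial ℝ, cfc f A = Polynomial.aeval A p ∧ cfc f B = Polynomial.aeval B p := by
  classical
  have hfin : (spectrum ℝ A ∪ spectrum ℝ B).Finite :=
    A.finite_real_spectrum.union B.finite_real_spectrum
  have hp : ∀ x ∈ spectrum ℝ A ∪ spectrum ℝ B,
      f x = (Lagrange.interpolate hfin.toFinset id f).eval x := fun x hx =>
    (Lagrange.eval_interpolate_at_node (v := id) f Function.injective_id.injOn
      (hfin.mem_toFinset.2 hx)).symm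
  refine ⟨Lagrange.interpolate hfin.toFinset id f, ?_, ?_⟩
  · rw [← cfc_polynomial _ A hA.isSelfAdjoint]
    exact cfc_congr fun x hx => hp x (Or.inl hx)
  · rw [← cfc_polynomial _ B hB.isSelfAdjoint]
    exact cfc_congr fun x hx => hp x (Or.inr hx)

/-- The functional calculus respects intertwining by a rectangular matrix. -/
theorem cfc_mul_eq_mul_cfc [DecidableEq κ] {A : Matrix ι ι ℂ} {B : Matrix κ κ ℂ}
    (hA : A.IsHermitian) (hB : B.IsHermitian) {W : Matrix ι κ ℂ} (h : A * W = W * B) (f : ℝ → ℝ) :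
    cfc f A * W = W * cfc f B := by
  obtain ⟨p, h1, h2⟩ := exists_polynomial_cfc_eq hA hB f
  rw [h1, h2]
  clear h1 h2
  induction p using Polynomial.induction_on' with
  | add p q hp hq => simp [Matrix.add_mul, Matrix.mul_add, hp, hq]
  | monomial k a =>
    have : A ^ k * W = W * B ^ k := by
      induction k with
      | zero => simp
      | succ k ih => rw [pow_succ, Matrix.mul_assoc, h, ← Matrix.mul_assoc, ih, pow_succ,
          Matrix.mul_assoc]
    simp only [Polynomial.aeval_monomial, Algebra.algebraMap_eq_smul_one, Matrix.smul_mul,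
      Matrix.mul_smul, Matrix.one_mul, this]

lemma cfc_mulVec_eq {A : Matrix ι ι ℂ} (hA : A.IsHermitian) {u : ι → ℂ} {t : ℝ}
    (h : A *ᵥ u = (t : ℂ) • u) (f : ℝ → ℝ) : cfc f A *ᵥ u = (f t : ℂ) • u := by
  -- the vector `u` as a one-column matrix intertwines `A` with the `1 × 1` matrix `t`
  have hB : (algebraMap ℝ (Matrix Unit Unit ℂ) t).IsHermitian := by
    ext; simp [Matrix.algebraMap_matrix_apply]
  have h1 : A * replicateCol Unit u = replicateCol Unit u *
      algebraMap ℝ (Matrix Unit Unit ℂ) t := by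
    ext i j
    have := congrFun h i
    simp only [mulVec, dotProduct, Pi.smul_apply, smul_eq_mul] at this
    simp [Matrix.mul_apply, Matrix.algebraMap_matrix_apply, this, mul_comm]
  have h2 := cfc_mul_eq_mul_cfc hA hB h1 f
  rw [cfc_algebraMap] at h2
  ext i
  have := congrFun (congrFun h2 i) ()
  simp only [Matrix.mul_apply, replicateCol_apply, Finset.univ_unique,
    Matrix.algebraMap_matrix_apply, Finset.sum_singleton, if_true] at this
  simp only [mulVec, dotProduct, this, Pi.smul_apply, smul_eq_mul]
  exact mul_comm _ _

lemma isHermitian_cfc (f : ℝ → ℝ) (A : Matrix ι ι ℂ) : (cfc f A).IsHermitian :=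
  cfc_predicate f A

/-- Continuity of the functional calculus in the matrix. No bound on the spectra of the `Y a` is
assumed: near `A` they lie in the given neighbourhood of the spectrum of `A`. -/
theorem tendsto_cfc_of_mem_nhdsSet {α : Type*} {l : Filter α} {Y : α → Matrix ι ι ℂ}
    {A : Matrix ι ι ℂ} (hY : Tendsto Y l (𝓝 A)) (hYh : ∀ᶠ a in l, (Y a).IsHermitian)
    (hA : A.IsHermitian) {s : Set ℝ} (hs : s ∈ 𝓝ˢ (spectrum ℝ A)) {f : ℝ → ℝ}
    (hf : ContinuousOn f s) : Tendsto (fun a => cfc f (Y a)) l (𝓝 (cfc f A)) := by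
  obtain ⟨k, ⟨hka, hk⟩, hks⟩ :=
    (A.finite_real_spectrum.isCompact).nhdsSet_basis_isCompact.mem_iff.mp hs
  open scoped Matrix.Norms.L2Operator in
  have h1 : ∀ᶠ a in l, k ∈ 𝓝ˢ (spectrum ℝ (Y a)) :=
    hY.eventually (((upperHemicontinuous_spectrum ℝ (Matrix ι ι ℂ)).isOpen k).mem_nhds hka)
  open scoped Matrix.Norms.L2Operator in
  exact hY.cfc hk f (h1.mono fun a ha => subset_of_mem_nhdsSet ha)
    (hYh.mono fun a ha => ha.isSelfAdjoint) (subset_of_mem_nhdsSet hka) hA.isSelfAdjoint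
    (hf.mono hks)

lemma posDef_iff_spectrum {A : Matrix ι ι ℂ} :
    A.PosDef ↔ A.IsHermitian ∧ spectrum ℝ A ⊆ Set.Ioi 0 := by
  constructor
  · intro h
    refine ⟨h.1, ?_⟩
    rw [h.1.spectrum_real_eq_range_eigenvalues]
    rintro _ ⟨i, rfl⟩
    exact h.eigenvalues_pos i
  · rintro ⟨h1, h2⟩
    refine h1.posDef_iff_eigenvalues_pos.2 fun i => h2 ?_
    rw [h1.spectrum_real_eq_range_eigenvalues]
    exact ⟨i, rfl⟩

/-! ### Divided differences -/

lemma divDiff_eq_dslope (f : ℝ → ℝ) (s t : ℝ) : divDiff f s t = dslope f s t := by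
  unfold divDiff
  split_ifs with h
  · subst h; simp
  · rw [dslope_of_ne _ (Ne.symm h), slope_def_field, ← neg_sub (f s), ← neg_sub s, neg_div_neg_eq]

lemma divDiff_mul_sub (f : ℝ → ℝ) (s t : ℝ) : (t - s) * divDiff f s t = f t - f s := by
  rw [divDiff_eq_dslope]; simpa using sub_smul_dslope f s t

lemma divDiff_comm (f : ℝ → ℝ) (s t : ℝ) : divDiff f s t = divDiff f t s := by
  unfold divDiff
  split_ifs with h h' h'
  · rw [h]
  · exact absurd h.symm h'
  · exact absurd h'.symm h
  · rw [← neg_sub (f t), ← neg_sub t, neg_div_neg_eq]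

lemma continuousOn_divDiff {f : ℝ → ℝ} (hf : DifferentiableOn ℝ f (Set.Ioi 0)) {s : ℝ}
    (hs : 0 < s) : ContinuousOn (divDiff f s) (Set.Ioi 0) := by
  have : divDiff f s = dslope f s := funext (divDiff_eq_dslope f s)
  rw [this, continuousOn_dslope (Ioi_mem_nhds hs)]
  exact ⟨hf.continuousOn, hf.differentiableAt (Ioi_mem_nhds hs)⟩

/-! ### The derivative of a quadratic form of a function of a matrix -/

/-- If `r` is a left eigenvector of `A₀`, the change of `r f(A₀)` under a perturbation of `A₀` is
exactly linear in the perturbation, up to a factor `cfc (divDiff f t) A` which is continuous in `A`.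
This is what makes a merely differentiable `f` differentiable on matrices. -/
lemma vecMul_cfc_sub {A A₀ : Matrix ι ι ℂ} (hA : A.IsHermitian) {r : ι → ℂ} {t : ℝ}
    (h : r ᵥ* A₀ = (t : ℂ) • r) (f : ℝ → ℝ) :
    r ᵥ* cfc f A - (f t : ℂ) • r = (r ᵥ* (A - A₀)) ᵥ* cfc (divDiff f t) A := by
  have h1 : cfc f A = (A - algebraMap ℝ _ t) * cfc (divDiff f t) A + algebraMap ℝ _ (f t) := by
    have hc := fun g : ℝ → ℝ => continuousOn_spectrum_matrix (A := A) g
    have : f = fun x => (x - t) * divDiff f t x + f t := by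
      funext x; rw [divDiff_mul_sub]; ring
    conv_lhs => rw [this]
    rw [cfc_add_const _ _ A (hc _) hA.isSelfAdjoint, cfc_mul _ _ A (hc _) (hc _),
      cfc_sub _ _ A (hc _) (hc _), cfc_const _ A hA.isSelfAdjoint, cfc_id' ℝ A hA.isSelfAdjoint]
  have h2 : r ᵥ* (A - A₀) = r ᵥ* (A - algebraMap ℝ _ t) := by
    rw [vecMul_sub, vecMul_sub, h, Algebra.algebraMap_eq_smul_one, vecMul_smul, vecMul_one]
    rfl
  rw [h2, vecMul_vecMul, h1, vecMul_add, Algebra.algebraMap_eq_smul_one (f t), vecMul_smul,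
    vecMul_one]
  exact add_sub_cancel_right _ _

lemma tendsto_vecMul_vecMul_dotProduct {ι α : Type*} [Fintype ι] {l : Filter α}
    {F G : α → Matrix ι ι ℂ} {F₀ G₀ : Matrix ι ι ℂ} (hF : Tendsto F l (𝓝 F₀))
    (hG : Tendsto G l (𝓝 G₀)) (r ζ : ι → ℂ) :
    Tendsto (fun a => ((r ᵥ* F a) ᵥ* G a) ⬝ᵥ ζ) l (𝓝 (((r ᵥ* F₀) ᵥ* G₀) ⬝ᵥ ζ)) := by
  have hF' := fun i j => tendsto_pi_nhds.1 (tendsto_pi_nhds.1 hF i) j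
  have hG' := fun i j => tendsto_pi_nhds.1 (tendsto_pi_nhds.1 hG i) j
  simp only [vecMul, dotProduct]
  exact tendsto_finsetSum _ fun i _ => (tendsto_finsetSum _ fun j _ =>
    (tendsto_finsetSum _ fun k _ => (hF' k j).const_mul _).mul (hG' j i)).mul_const _

/-- The derivative of `⟨ζ, f(A(τ)) ζ⟩` at `τ₀`, in terms of an expansion of `ζ` in eigenvectors of
`A(τ₀)`. Differentiability of the path is given as a factorization
`A(τ) - A(τ₀) = (τ - τ₀) H(τ)` with `H` continuous, so `H(τ₀)` is its derivative. -/
theorem hasDerivAt_quadForm_cfc {f : ℝ → ℝ} (hf : DifferentiableOn ℝ f (Set.Ioi 0))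
    {A H : ℝ → Matrix ι ι ℂ} {τ₀ : ℝ} (hA : ∀ τ, (A τ).IsHermitian)
    (hpos : (A τ₀).PosDef) (hAH : ∀ τ, A τ - A τ₀ = ((τ - τ₀ : ℝ) : ℂ) • H τ)
    (hH : Continuous H) {u : κ → ι → ℂ} {t : κ → ℝ}
    (hu : ∀ k, A τ₀ *ᵥ u k = (t k : ℂ) • u k) (ht : ∀ k, 0 < t k) {z : κ → ℂ} {ζ : ι → ℂ}
    (hζ : ζ = ∑ k, z k • u k) :
    HasDerivAt (fun τ => star ζ ⬝ᵥ (cfc f (A τ) *ᵥ ζ))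
      (∑ i, ∑ j, star (z i) * z j * (divDiff f (t i) (t j) : ℂ) *
        (star (u i) ⬝ᵥ (H τ₀ *ᵥ u j))) τ₀ := by
  have hr : ∀ k, star (u k) ᵥ* A τ₀ = (t k : ℂ) • star (u k) := fun k => by
    have := congrArg star (hu k)
    rw [star_mulVec, (hA τ₀).eq] at this
    rw [this]; ext; simp
  have hstar : star ζ = ∑ k, star (z k) • star (u k) := by rw [hζ]; simp
  have hcont : Continuous A := by
    have : A = fun τ => A τ₀ + ((τ - τ₀ : ℝ) : ℂ) • H τ := by
      funext τ; rw [← hAH]; abel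
    rw [this]
    fun_prop
  rw [hasDerivAt_iff_tendsto_slope]
  let F : ℝ → ℂ := fun τ => ∑ i, star (z i) *
    (((star (u i) ᵥ* H τ) ᵥ* cfc (divDiff f (t i)) (A τ)) ⬝ᵥ ζ)
  have hF : Tendsto F (𝓝 τ₀) (𝓝 (F τ₀)) := by
    refine tendsto_finsetSum _ fun i _ => Tendsto.const_mul _ ?_
    have h1 : Tendsto (fun τ => cfc (divDiff f (t i)) (A τ)) (𝓝 τ₀)
        (𝓝 (cfc (divDiff f (t i)) (A τ₀))) :=
      tendsto_cfc_of_mem_nhdsSet hcont.continuousAt (.of_forall hA) (hA τ₀)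
        (isOpen_Ioi.mem_nhdsSet.2 (posDef_iff_spectrum.1 hpos).2) (continuousOn_divDiff hf (ht i))
    exact tendsto_vecMul_vecMul_dotProduct (hH.tendsto τ₀) h1 _ _
  have hF0 : F τ₀ = ∑ i, ∑ j, star (z i) * z j * (divDiff f (t i) (t j) : ℂ) *
        (star (u i) ⬝ᵥ (H τ₀ *ᵥ u j)) := by
    refine Finset.sum_congr rfl fun i _ => ?_
    rw [← dotProduct_mulVec, hζ, mulVec_sum, dotProduct_sum, Finset.mul_sum]
    refine Finset.sum_congr rfl fun j _ => ?_
    rw [mulVec_smul, cfc_mulVec_eq (hA τ₀) (hu j), dotProduct_smul, dotProduct_smul,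
      ← dotProduct_mulVec]
    simp only [smul_eq_mul]; ring
  rw [← hF0]
  refine (hF.mono_left nhdsWithin_le_nhds).congr' ?_
  filter_upwards [self_mem_nhdsWithin] with τ hτ
  have hne : ((τ - τ₀ : ℝ) : ℂ) ≠ 0 := by
    exact_mod_cast sub_ne_zero.2 hτ
  have key : ∀ i, star (u i) ᵥ* cfc f (A τ) - star (u i) ᵥ* cfc f (A τ₀) =
      ((τ - τ₀ : ℝ) : ℂ) • ((star (u i) ᵥ* H τ) ᵥ* cfc (divDiff f (t i)) (A τ)) := fun i => by
    have h1 := vecMul_cfc_sub (hA τ) (hr i) f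
    have h2 := vecMul_cfc_sub (hA τ₀) (hr i) f
    rw [sub_self, vecMul_zero, zero_vecMul, sub_eq_zero] at h2
    rw [h2, h1, hAH, vecMul_smul, smul_vecMul]
  have h3 : star ζ ⬝ᵥ (cfc f (A τ) *ᵥ ζ) - star ζ ⬝ᵥ (cfc f (A τ₀) *ᵥ ζ) =
      ((τ - τ₀ : ℝ) : ℂ) * F τ := by
    rw [dotProduct_mulVec, dotProduct_mulVec, ← sub_dotProduct, hstar, sum_vecMul, sum_vecMul,
      ← Finset.sum_sub_distrib, sum_dotProduct, Finset.mul_sum]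
    refine Finset.sum_congr rfl fun i _ => ?_
    rw [smul_vecMul, smul_vecMul, ← smul_sub, key, smul_smul, smul_dotProduct]
    simp only [smul_eq_mul]; ring
  rw [slope_def_module, h3, ← Complex.coe_smul, smul_eq_mul, Complex.ofReal_inv,
    inv_mul_cancel_left₀ hne]

end FunctionalCalculus

/-! ### Quadratic forms and cutoffs -/

section QuadraticForms

variable {ι κ : Type*} [Fintype ι] [Fintype κ]

lemma posSemidef_of_re_nonneg {A : Matrix ι ι ℂ} (hA : A.IsHermitian)
    (h : ∀ x, 0 ≤ (star x ⬝ᵥ (A *ᵥ x)).re) : A.PosSemidef := by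
  refine .of_dotProduct_mulVec_nonneg hA fun x => ?_
  exact Complex.nonneg_iff.2 ⟨h x, (hA.im_star_dotProduct_mulVec_self x).symm⟩

lemma re_quadForm_nonneg {A : Matrix ι ι ℂ} (hA : A.PosSemidef) (x : ι → ℂ) :
    0 ≤ (star x ⬝ᵥ (A *ᵥ x)).re :=
  (Complex.nonneg_iff.1 (hA.dotProduct_mulVec_nonneg x)).1

open scoped MatrixOrder in
lemma quadForm_cfc_mono [DecidableEq ι] {A : Matrix ι ι ℂ} {f g : ℝ → ℝ}
    (h : ∀ x ∈ spectrum ℝ A, f x ≤ g x) (x : ι → ℂ) :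
    (star x ⬝ᵥ (cfc f A *ᵥ x)).re ≤ (star x ⬝ᵥ (cfc g A *ᵥ x)).re := by
  have h1 : cfc f A ≤ cfc g A := cfc_mono h (continuousOn_spectrum_matrix f)
    (continuousOn_spectrum_matrix g)
  have h2 := re_quadForm_nonneg (Matrix.le_iff.1 h1) x
  rw [sub_mulVec, dotProduct_sub, Complex.sub_re] at h2
  linarith

lemma star_mulVec_dotProduct_mulVec (V : Matrix ι κ ℂ) (M : Matrix ι ι ℂ) (v : κ → ℂ) :
    star (V *ᵥ v) ⬝ᵥ (M *ᵥ (V *ᵥ v)) = star v ⬝ᵥ ((Vᴴ * M * V) *ᵥ v) := by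
  rw [star_mulVec, ← dotProduct_mulVec, mulVec_mulVec, mulVec_mulVec, Matrix.mul_assoc]

/-- A function continuous on `(0, ∞)` becomes continuous on the line after multiplication by the
cutoff that vanishes on `(-∞, η]` and equals `1` on `[2η, ∞)`. -/
lemma continuous_cutoff_mul {h : ℝ → ℝ} (hh : ContinuousOn h (Set.Ioi 0)) {η : ℝ} (hη : 0 < η) :
    Continuous fun x => max 0 (min 1 (x / η - 1)) * h x := by
  rw [continuous_iff_continuousAt]
  intro x
  rcases lt_or_ge x η with hx | hx
  · have : (fun x => max 0 (min 1 (x / η - 1)) * h x) =ᶠ[𝓝 x] fun _ => 0 := by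
      filter_upwards [Iio_mem_nhds hx] with y hy
      have : y / η ≤ 1 := (div_le_one hη).2 (le_of_lt hy)
      rw [max_eq_left ((min_le_right _ _).trans (by linarith)), zero_mul]
    exact continuousAt_const.congr this.symm
  · have h1 : ContinuousAt h x := hh.continuousAt (Ioi_mem_nhds (hη.trans_le hx))
    have h2 : Continuous fun x : ℝ => max 0 (min 1 (x / η - 1)) := by fun_prop
    exact h2.continuousAt.mul h1

/-- Let positive definite matrices `Y` tend to the singular matrix `V C V*`, with `C` positive
definite. If `h` is nonnegative near `0`, then an upper bound for `⟨Vv, h(Y) Vv⟩` passes to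
`⟨v, h(C) v⟩`, although `h(V C V*)` need not make sense. -/
theorem quadForm_cfc_le_of_tendsto [DecidableEq ι] [DecidableEq κ] {h : ℝ → ℝ}
    (hh : ContinuousOn h (Set.Ioi 0)) {δ : ℝ} (hδ : 0 < δ) (h0 : ∀ t, 0 < t → t < δ → 0 ≤ h t)
    {V : Matrix ι κ ℂ} (hV : Vᴴ * V = 1)
    {C : Matrix κ κ ℂ} (hC : C.PosDef) {α : Type*} {l : Filter α} [NeBot l]
    {Y : α → Matrix ι ι ℂ} (hY : Tendsto Y l (𝓝 (V * C * Vᴴ))) (hYp : ∀ᶠ a in l, (Y a).PosDef)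
    (v : κ → ℂ) {K : ℝ}
    (hle : ∀ᶠ a in l, (star (V *ᵥ v) ⬝ᵥ (cfc h (Y a) *ᵥ (V *ᵥ v))).re ≤ K) :
    (star v ⬝ᵥ (cfc h C *ᵥ v)).re ≤ K := by
  obtain ⟨m, hm, hmC⟩ : ∃ m > 0, ∀ x ∈ spectrum ℝ C, m ≤ x := by
    rcases (spectrum ℝ C).eq_empty_or_nonempty with he | hne
    · exact ⟨1, one_pos, by simp [he]⟩
    · obtain ⟨m, hm1, hm2⟩ := C.finite_real_spectrum.exists_minimalFor id _ hne
      exact ⟨m, (posDef_iff_spectrum.1 hC).2 hm1, fun x hx => by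
        rcases le_total m x with h | h
        · exact h
        · exact hm2 hx h⟩
  -- the cutoff at `η` leaves `h` unchanged on the spectrum of `C` and does not increase it
  set η := min m δ / 2 with hηdef
  have hη : 0 < η := by positivity
  have hηm : 2 * η ≤ m := by rw [hηdef]; linarith [min_le_left m δ]
  have hηδ : 2 * η ≤ δ := by rw [hηdef]; linarith [min_le_right m δ]
  set k : ℝ → ℝ := fun x => max 0 (min 1 (x / η - 1)) * h x with hk
  have hkc : Continuous k := continuous_cutoff_mul hh hη
  have hone : ∀ x, 2 * η ≤ x → k x = h x := fun x hx => by
    have : 2 ≤ x / η := (le_div_iff₀ hη).2 hx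
    rw [hk]; simp only
    rw [min_eq_left (by linarith), max_eq_right zero_le_one, one_mul]
  have hkle : ∀ x, 0 < x → k x ≤ h x := fun x hx => by
    rcases le_or_gt (2 * η) x with h1 | h1
    · exact (hone x h1).le
    · exact mul_le_of_le_one_left (h0 x hx (by linarith)) (max_le zero_le_one (min_le_left _ _))
  have hCV : (V * C * Vᴴ).IsHermitian := isHermitian_mul_mul_conjTranspose V hC.1
  have hlim : Tendsto (fun a => cfc k (Y a)) l (𝓝 (cfc k (V * C * Vᴴ))) :=
    tendsto_cfc_of_mem_nhdsSet hY (hYp.mono fun a ha => ha.1) hCV Filter.univ_mem hkc.continuousOn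
  have hint : cfc k (V * C * Vᴴ) * V = V * cfc k C :=
    cfc_mul_eq_mul_cfc hCV hC.1 (by rw [Matrix.mul_assoc, hV, Matrix.mul_one]) k
  have hval : star (V *ᵥ v) ⬝ᵥ (cfc k (V * C * Vᴴ) *ᵥ (V *ᵥ v)) = star v ⬝ᵥ (cfc h C *ᵥ v) := by
    rw [star_mulVec_dotProduct_mulVec, Matrix.mul_assoc, hint, ← Matrix.mul_assoc, hV,
      Matrix.one_mul, cfc_congr fun x hx => hone x (hηm.trans (hmC x hx))]
  rw [← hval]
  have hcont : Continuous fun M : Matrix ι ι ℂ => (star (V *ᵥ v) ⬝ᵥ (M *ᵥ (V *ᵥ v))).re := by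
    fun_prop
  refine le_of_tendsto ((hcont.tendsto _).comp hlim) ?_
  filter_upwards [hle, hYp] with a h1 h2
  exact (quadForm_cfc_mono (fun x hx => hkle x ((posDef_iff_spectrum.1 h2).2 hx)) _).trans h1

lemma Matrix.PosDef.exists_eigenvector_expansion [DecidableEq ι] {A : Matrix ι ι ℂ}
    (hA : A.PosDef) (ζ : ι → ℂ) :
    ∃ (u : ι → ι → ℂ) (t : ι → ℝ) (z : ι → ℂ), (∀ k, A *ᵥ u k = (t k : ℂ) • u k) ∧
      (∀ k, 0 < t k) ∧ ζ = ∑ k, z k • u k := by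
  refine ⟨fun k => hA.1.eigenvectorBasis k, hA.1.eigenvalues,
    fun k => hA.1.eigenvectorBasis.repr (WithLp.toLp 2 ζ) k, fun k => ?_, hA.eigenvalues_pos, ?_⟩
  · exact hA.1.mulVec_eigenvectorBasis k
  · have := congrArg (WithLp.ofLp) (hA.1.eigenvectorBasis.sum_repr (WithLp.toLp 2 ζ))
    simpa using this.symm

/-! ### Conditionally positive definite kernels -/

/-- The kernel `K` on `(0, ∞)` is conditionally positive definite on `ι`-indexed families of points:
`∑ᵢⱼ x̄ᵢ xⱼ K(tᵢ, tⱼ) ≥ 0` whenever `∑ᵢ xᵢ = 0`. The points need not be distinct. The real part is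
taken because a general `K` is not assumed symmetric. -/
def IsCondPosKernel (K : ℝ → ℝ → ℝ) (ι : Type*) [Fintype ι] : Prop :=
  ∀ t : ι → ℝ, (∀ i, 0 < t i) → ∀ x : ι → ℂ, ∑ i, x i = 0 →
    0 ≤ (∑ i, ∑ j, star (x i) * x j * (K (t i) (t j) : ℂ)).re

/-- A conditionally positive definite kernel remains nonnegative after Schur multiplication by the
Gram matrix of the vectors `Q uᵢ`, provided the projection `Q` annihilates `∑ zᵢ uᵢ`. -/
lemma IsCondPosKernel.sum_projection_nonneg {K : ℝ → ℝ → ℝ} (hK : IsCondPosKernel K ι)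
    {Q : Matrix κ κ ℂ} (hQ : Q * Q = Q) (hQh : Qᴴ = Q) {t : ι → ℝ} (ht : ∀ i, 0 < t i)
    {z : ι → ℂ} {u : ι → κ → ℂ} (hz : Q *ᵥ (∑ k, z k • u k) = 0) :
    0 ≤ (∑ i, ∑ j, star (z i) * z j * (K (t i) (t j) : ℂ) * (star (u i) ⬝ᵥ (Q *ᵥ u j))).re := by
  have h1 : ∀ i j, star (u i) ⬝ᵥ (Q *ᵥ u j) = ∑ a, star ((Q *ᵥ u i) a) * (Q *ᵥ u j) a := by
    intro i j
    have : star (u i) ⬝ᵥ (Q *ᵥ u j) = star (Q *ᵥ u i) ⬝ᵥ (Q *ᵥ u j) := by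
      rw [star_mulVec, hQh, ← dotProduct_mulVec, mulVec_mulVec, hQ]
    rw [this]; rfl
  have h2 : ∑ i, ∑ j, star (z i) * z j * (K (t i) (t j) : ℂ) * (star (u i) ⬝ᵥ (Q *ᵥ u j)) =
      ∑ a, ∑ i, ∑ j, star (z i * (Q *ᵥ u i) a) * (z j * (Q *ᵥ u j) a) * (K (t i) (t j) : ℂ) := by
    rw [Finset.sum_comm]
    rw [Finset.sum_comm (s := Finset.univ (α := κ))]
    conv_rhs => enter [2, i]; rw [Finset.sum_comm]
    rw [Finset.sum_comm]
    refine Finset.sum_congr rfl fun i _ => Finset.sum_congr rfl fun j _ => ?_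
    rw [h1, Finset.mul_sum]
    refine Finset.sum_congr rfl fun a _ => ?_
    rw [star_mul']; ring
  rw [h2, Complex.re_sum]
  refine Finset.sum_nonneg fun a _ => hK t ht _ ?_
  rw [mulVec_sum] at hz
  have := congrFun hz a
  simpa [mulVec_smul] using this

/-! ### Compressions by isometries -/

lemma compl_range_projection [DecidableEq ι] [DecidableEq κ] {V : Matrix ι κ ℂ} (hV : Vᴴ * V = 1) :
    (1 - V * Vᴴ) * (1 - V * Vᴴ) = 1 - V * Vᴴ ∧ (1 - V * Vᴴ)ᴴ = 1 - V * Vᴴ ∧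
      (1 - V * Vᴴ) * V = 0 := by
  have h3 : (1 - V * Vᴴ) * V = 0 := by
    rw [Matrix.sub_mul, Matrix.mul_assoc, hV]; simp
  refine ⟨?_, by simp, h3⟩
  rw [Matrix.mul_sub, ← Matrix.mul_assoc, h3]; simp

lemma hasDerivAt_re {φ : ℝ → ℂ} {d : ℂ} {x : ℝ} (h : HasDerivAt φ d x) :
    HasDerivAt (fun y => (φ y).re) d.re x :=
  (Complex.reCLM.hasFDerivAt.comp_hasDerivAt x h)

lemma tendsto_matrix_inv [DecidableEq ι] {α : Type*} {l : Filter α} {M : α → Matrix ι ι ℂ}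
    {M₀ N : Matrix ι ι ℂ}
    (hM : Tendsto M l (𝓝 M₀)) (hN : M₀ * N = 1) : Tendsto (fun a => (M a)⁻¹) l (𝓝 N) := by
  have h1 : N = M₀.det⁻¹ • M₀.adjugate := by
    rw [← inv_eq_right_inv hN, Matrix.inv_def, Ring.inverse_eq_inv']
  have hdet : M₀.det ≠ 0 := by
    intro h
    have := congrArg det hN
    rw [det_mul, h, det_one, zero_mul] at this
    exact zero_ne_one this
  simp_rw [Matrix.inv_def, Ring.inverse_eq_inv', h1]
  have hc1 : Continuous fun A : Matrix ι ι ℂ => A.det := continuous_id.matrix_det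
  have hc2 : Continuous fun A : Matrix ι ι ℂ => A.adjugate := continuous_id.matrix_adjugate
  exact (((hc1.tendsto _).comp hM).inv₀ hdet).smul ((hc2.tendsto _).comp hM)

lemma cfc_comp_inv_of_posDef [DecidableEq ι] {A : Matrix ι ι ℂ} (hA : A.PosDef) (f : ℝ → ℝ) :
    cfc (fun x => f x⁻¹) A⁻¹ = cfc f A := by
  obtain ⟨U, hU⟩ := hA.inv.isUnit
  have h := cfc_comp_inv f U ((hU ▸ A⁻¹.finite_real_spectrum.image _).continuousOn f)
    (by rw [hU]; exact hA.inv.1.isSelfAdjoint)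
  have hdet : IsUnit A.det := (Matrix.isUnit_iff_isUnit_det _).1 hA.isUnit
  rw [Matrix.coe_units_inv, hU, nonsing_inv_nonsing_inv _ hdet] at h
  exact h

lemma mulVec_injective_of_mul_eq_one [DecidableEq κ] {V : Matrix ι κ ℂ} {W : Matrix κ ι ℂ}
    (h : W * V = 1) : Function.Injective V.mulVec := fun x y hxy => by
  have := congrArg (W *ᵥ ·) hxy
  simpa [mulVec_mulVec, h] using this

end QuadraticForms

section Compression

variable {ι κ : Type*} [Fintype ι] [DecidableEq ι] [Fintype κ] [DecidableEq κ]

lemma one_sub_add_smul_mul_one_sub_add_smul {Q : Matrix ι ι ℂ} (hQ : Q * Q = Q) (a b : ℂ) :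
    (1 - Q + a • Q) * (1 - Q + b • Q) = 1 - Q + (a * b) • Q := by
  simp only [Matrix.mul_add, Matrix.add_mul, Matrix.mul_sub, Matrix.sub_mul, Matrix.one_mul,
    Matrix.mul_one, Matrix.smul_mul, Matrix.mul_smul, hQ]
  module

/-- Jensen's inequality for a compression, when `-f[s, t]` is a conditionally positive definite
kernel and `f` is nonnegative near `∞`: the form `⟨ζ, f(X + τQ) ζ⟩` decreases from `⟨ζ, f(X) ζ⟩` at
`τ = 0` to at least `⟨v, f(V* X V) v⟩` as `τ → ∞`. -/
theorem quadForm_cfc_compression_le_of_atTop {f : ℝ → ℝ}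
    (hf : DifferentiableOn ℝ f (Set.Ioi 0))
    (hK : IsCondPosKernel (fun s t => -divDiff f s t) ι)
    {M : ℝ} (hM : 0 < M) (hfM : ∀ t, M < t → 0 ≤ f t) {X : Matrix ι ι ℂ} (hX : X.PosDef)
    {V : Matrix ι κ ℂ} (hV : Vᴴ * V = 1) (v : κ → ℂ) :
    (star v ⬝ᵥ (cfc f (Vᴴ * X * V) *ᵥ v)).re ≤
      (star v ⬝ᵥ ((Vᴴ * cfc f X * V) *ᵥ v)).re := by
  obtain ⟨hQ, hQh, hQV⟩ := compl_range_projection hV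
  set Q := 1 - V * Vᴴ with hQdef
  have hQV' : Vᴴ * Q = 0 := by
    have := congrArg conjTranspose hQV
    rwa [conjTranspose_mul, hQh, conjTranspose_zero] at this
  have hP : 1 - Q = V * Vᴴ := by rw [hQdef]; abel
  have hQpos : Q.PosSemidef := by
    have := posSemidef_conjTranspose_mul_self Q
    rwa [hQh, hQ] at this
  set A : ℝ → Matrix ι ι ℂ := fun τ => X + (τ : ℂ) • Q with hA
  have hherm : ∀ τ, (A τ).IsHermitian := fun τ => by
    refine hX.1.add ?_
    rw [IsHermitian, conjTranspose_smul, hQh]; simp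
  have hpos : ∀ τ, 0 ≤ τ → (A τ).PosDef := fun τ hτ =>
    hX.add_posSemidef (hQpos.smul (by exact_mod_cast hτ))
  set ζ := V *ᵥ v with hζ
  have hQζ : Q *ᵥ ζ = 0 := by rw [hζ, mulVec_mulVec, hQV, zero_mulVec]
  have hderiv : ∀ τ, 0 ≤ τ → ∃ d : ℝ, d ≤ 0 ∧
      HasDerivAt (fun τ => (star ζ ⬝ᵥ (cfc f (A τ) *ᵥ ζ)).re) d τ := by
    intro τ hτ
    obtain ⟨u, t, z, hu, ht, hz⟩ := (hpos τ hτ).exists_eigenvector_expansion ζ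
    refine ⟨_, ?_, hasDerivAt_re (hasDerivAt_quadForm_cfc hf hherm (hpos τ hτ)
      (H := fun _ => Q) (fun σ => ?_) continuous_const hu ht hz)⟩
    · have := hK.sum_projection_nonneg hQ hQh ht (hz ▸ hQζ)
      rw [← neg_nonneg, ← Complex.neg_re]
      convert this using 2
      simp [Finset.sum_neg_distrib]
    · simp only [hA, Complex.ofReal_sub, sub_smul]; abel
  have hanti : AntitoneOn (fun τ => (star ζ ⬝ᵥ (cfc f (A τ) *ᵥ ζ)).re) (Set.Ici 0) := by
    refine antitoneOn_of_deriv_nonpos (convex_Ici 0) (fun τ hτ => ?_) (fun τ hτ => ?_)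
      fun τ hτ => ?_
    · obtain ⟨d, -, h⟩ := hderiv τ hτ
      exact h.continuousAt.continuousWithinAt
    · rw [interior_Ici] at hτ
      obtain ⟨d, -, h⟩ := hderiv τ (le_of_lt hτ)
      exact h.differentiableAt.differentiableWithinAt
    · rw [interior_Ici] at hτ
      obtain ⟨d, hd, h⟩ := hderiv τ (le_of_lt hτ)
      rw [h.deriv]; exact hd
  set C := Vᴴ * X * V with hC
  have hVinj : Function.Injective V.mulVec := mulVec_injective_of_mul_eq_one hV
  have hCpos : C.PosDef := hX.conjTranspose_mul_mul_same hVinj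
  have hCdet : IsUnit C.det := (Matrix.isUnit_iff_isUnit_det _).1 hCpos.isUnit
  -- With `τ = σ⁻²`, `(X + τQ)⁻¹ = S (S X S + Q)⁻¹ S`, where the inverse on the right stays
  -- continuous up to `σ = 0`.
  set S : ℝ → Matrix ι ι ℂ := fun σ => 1 - Q + (σ : ℂ) • Q with hS
  have hSQ : ∀ σ, S σ * Q = (σ : ℂ) • Q := fun σ => by
    simp [hS, Matrix.add_mul, Matrix.sub_mul, hQ]
  have hinv : ∀ σ : ℝ, 0 < σ → (A ((σ ^ 2)⁻¹))⁻¹ = S σ * (S σ * X * S σ + Q)⁻¹ * S σ := by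
    intro σ hσ
    have hσ' : (σ : ℂ) ≠ 0 := by exact_mod_cast hσ.ne'
    have hSS : S σ * S σ⁻¹ = 1 := by
      simp only [hS]
      rw [one_sub_add_smul_mul_one_sub_add_smul hQ]
      push_cast
      rw [mul_inv_cancel₀ hσ', one_smul, sub_add_cancel]
    have hSu : IsUnit (S σ).det := by
      have := congrArg det hSS
      rw [det_mul, det_one] at this
      exact IsUnit.of_mul_eq_one _ this
    have h1 : S σ * A ((σ ^ 2)⁻¹) * S σ = S σ * X * S σ + Q := by
      simp only [hA, Matrix.mul_add, Matrix.add_mul, Matrix.mul_smul, Matrix.smul_mul]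
      congr 1
      have hQS : S σ * Q * S σ = ((σ : ℂ) ^ 2) • Q := by
        have : Q * S σ = (σ : ℂ) • Q := by simp [hS, Matrix.mul_add, Matrix.mul_sub, hQ]
        rw [hSQ, Matrix.smul_mul, this, smul_smul, sq]
      rw [hQS, smul_smul]
      push_cast
      rw [inv_mul_cancel₀ (pow_ne_zero 2 hσ'), one_smul]
    rw [← h1, Matrix.mul_inv_rev, Matrix.mul_inv_rev, ← Matrix.mul_assoc, ← Matrix.mul_assoc,
      Matrix.mul_nonsing_inv _ hSu, Matrix.one_mul, Matrix.mul_assoc,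
      Matrix.nonsing_inv_mul _ hSu, Matrix.mul_one]
  have hScont : Continuous S := by
    simp only [hS]; fun_prop
  have hS0 : S 0 = V * Vᴴ := by simp [hS, hP]
  have hlim : Tendsto (fun σ : ℝ => (A ((σ ^ 2)⁻¹))⁻¹) (𝓝[>] 0) (𝓝 (V * C⁻¹ * Vᴴ)) := by
    have h1 : Tendsto (fun σ => (S σ * X * S σ + Q)⁻¹) (𝓝 0) (𝓝 (V * C⁻¹ * Vᴴ + Q)) := by
      have hc : Continuous fun σ => S σ * X * S σ + Q := by fun_prop
      refine tendsto_matrix_inv (hc.tendsto 0) ?_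
      rw [hS0]
      have e1 : V * Vᴴ * X * (V * Vᴴ) * (V * C⁻¹ * Vᴴ) = V * Vᴴ := by
        calc V * Vᴴ * X * (V * Vᴴ) * (V * C⁻¹ * Vᴴ)
            = V * (Vᴴ * X * V) * (Vᴴ * V) * C⁻¹ * Vᴴ := by simp only [Matrix.mul_assoc]
          _ = V * Vᴴ := by
            rw [hV, Matrix.mul_one, ← hC, Matrix.mul_assoc V C, Matrix.mul_nonsing_inv _ hCdet,
              Matrix.mul_one]
      have e2 : V * Vᴴ * X * (V * Vᴴ) * Q = 0 := by
        rw [Matrix.mul_assoc _ (V * Vᴴ), Matrix.mul_assoc V Vᴴ Q, hQV', Matrix.mul_zero,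
          Matrix.mul_zero]
      have e3 : Q * (V * C⁻¹ * Vᴴ) = 0 := by
        rw [← Matrix.mul_assoc, ← Matrix.mul_assoc, hQV, Matrix.zero_mul, Matrix.zero_mul]
      rw [Matrix.add_mul, Matrix.mul_add, Matrix.mul_add, e1, e2, e3, hQ, add_zero, zero_add,
        ← hP, sub_add_cancel]
    have h2 : Tendsto (fun σ => S σ * (S σ * X * S σ + Q)⁻¹ * S σ) (𝓝 0)
        (𝓝 (S 0 * (V * C⁻¹ * Vᴴ + Q) * S 0)) :=
      ((hScont.tendsto 0).mul h1).mul (hScont.tendsto 0)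
    have e : S 0 * (V * C⁻¹ * Vᴴ + Q) * S 0 = V * C⁻¹ * Vᴴ := by
      rw [Matrix.mul_add (S 0), hSQ, hS0]
      calc (V * Vᴴ * (V * C⁻¹ * Vᴴ) + ((0 : ℝ) : ℂ) • Q) * (V * Vᴴ)
          = V * (Vᴴ * V) * C⁻¹ * (Vᴴ * V) * Vᴴ := by
            rw [Complex.ofReal_zero, zero_smul, add_zero]; simp only [Matrix.mul_assoc]
        _ = V * C⁻¹ * Vᴴ := by rw [hV, Matrix.mul_one, Matrix.mul_one]
    rw [e] at h2
    refine (h2.mono_left nhdsWithin_le_nhds).congr' ?_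
    filter_upwards [self_mem_nhdsWithin] with σ hσ
    exact (hinv σ hσ).symm
  -- Inversion moves the end at infinity to `0`: `f(A) = h(A⁻¹)` with `h(x) = f(x⁻¹)`.
  have hfinal := quadForm_cfc_le_of_tendsto (h := fun x => f x⁻¹)
    (hf.continuousOn.comp (continuousOn_inv₀.mono fun x hx => ne_of_gt hx)
      fun x hx => Set.mem_Ioi.2 (inv_pos.2 hx))
    (inv_pos.2 hM) (fun t h1 h2 => hfM _ ((lt_inv_comm₀ h1 hM).1 h2)) hV hCpos.inv hlim
    (K := (star ζ ⬝ᵥ (cfc f X *ᵥ ζ)).re) ?_ v ?_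
  · rw [cfc_comp_inv_of_posDef hCpos, hζ, star_mulVec_dotProduct_mulVec] at hfinal
    exact hfinal
  · filter_upwards [self_mem_nhdsWithin] with σ hσ
    exact (hpos _ (by positivity)).inv
  · filter_upwards [self_mem_nhdsWithin] with σ hσ
    have hτ : (0 : ℝ) ≤ (σ ^ 2)⁻¹ := by positivity
    rw [cfc_comp_inv_of_posDef (hpos _ hτ)]
    have := hanti (Set.mem_Ici.2 le_rfl) (Set.mem_Ici.2 hτ) hτ
    have hA0 : A 0 = X := by simp [hA]
    simp only [hA0] at this
    exact this

lemma divDiff_id_mul {f : ℝ → ℝ} (hf : DifferentiableOn ℝ f (Set.Ioi 0)) {s t : ℝ} (hs : 0 < s) :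
    2 * divDiff (fun r => r * f r) s t = (s + t) * divDiff f s t + f s + f t := by
  unfold divDiff
  split_ifs with h
  · subst h
    have hd := hf.differentiableAt (Ioi_mem_nhds hs)
    have : deriv (fun r => r * f r) s = f s + s * deriv f s := by
      have := ((hasDerivAt_id' s).fun_mul hd.hasDerivAt).deriv
      simpa using this
    rw [this]; ring
  · have : s - t ≠ 0 := sub_ne_zero.2 h
    field_simp; ring

/-- Jensen's inequality for a compression, when the divided difference of `r f(r)` is a
conditionally positive definite kernel and `f` is nonnegative near `0`: with `S = 1 - Q + σQ`, the
form `⟨ζ, f(S X S) ζ⟩` increases from at least `⟨v, f(V* X V) v⟩` as `σ → 0` to `⟨ζ, f(X) ζ⟩` at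
`σ = 1`. -/
theorem quadForm_cfc_compression_le_of_zero {f : ℝ → ℝ}
    (hf : DifferentiableOn ℝ f (Set.Ioi 0))
    (hK : IsCondPosKernel (fun s t => divDiff (fun r => r * f r) s t) ι)
    {δ : ℝ} (hδ : 0 < δ) (hfδ : ∀ t, 0 < t → t < δ → 0 ≤ f t) {X : Matrix ι ι ℂ} (hX : X.PosDef)
    {V : Matrix ι κ ℂ} (hV : Vᴴ * V = 1) (v : κ → ℂ) :
    (star v ⬝ᵥ (cfc f (Vᴴ * X * V) *ᵥ v)).re ≤
      (star v ⬝ᵥ ((Vᴴ * cfc f X * V) *ᵥ v)).re := by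
  obtain ⟨hQ, hQh, hQV⟩ := compl_range_projection hV
  set Q := 1 - V * Vᴴ with hQdef
  have hP : 1 - Q = V * Vᴴ := by rw [hQdef]; abel
  set S : ℝ → Matrix ι ι ℂ := fun σ => 1 - Q + (σ : ℂ) • Q with hS
  have hSQ : ∀ σ, S σ * Q = (σ : ℂ) • Q := fun σ => by
    simp [hS, Matrix.add_mul, Matrix.sub_mul, hQ]
  have hQS : ∀ σ, Q * S σ = (σ : ℂ) • Q := fun σ => by
    simp [hS, Matrix.mul_add, Matrix.mul_sub, hQ]
  have hSh : ∀ σ, (S σ)ᴴ = S σ := fun σ => by simp [hS, hQh]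
  have hScont : Continuous S := by
    simp only [hS]; fun_prop
  set A : ℝ → Matrix ι ι ℂ := fun σ => S σ * X * S σ with hA
  have hherm : ∀ σ, (A σ).IsHermitian := fun σ => by
    rw [IsHermitian]; simp only [hA, conjTranspose_mul, hSh, hX.1.eq, Matrix.mul_assoc]
  have hpos : ∀ σ, 0 < σ → (A σ).PosDef := fun σ hσ => by
    have hσ' : (σ : ℂ) ≠ 0 := by exact_mod_cast hσ.ne'
    have hSS : S σ⁻¹ * S σ = 1 := by
      simp only [hS]
      rw [one_sub_add_smul_mul_one_sub_add_smul hQ]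
      push_cast
      rw [inv_mul_cancel₀ hσ', one_smul, sub_add_cancel]
    have := hX.conjTranspose_mul_mul_same (mulVec_injective_of_mul_eq_one hSS)
    rwa [hSh] at this
  set ζ := V *ᵥ v with hζ
  have hQζ : Q *ᵥ ζ = 0 := by rw [hζ, mulVec_mulVec, hQV, zero_mulVec]
  have hderiv : ∀ σ, 0 < σ → ∃ d : ℝ, 0 ≤ d ∧
      HasDerivAt (fun σ => (star ζ ⬝ᵥ (cfc f (A σ) *ᵥ ζ)).re) d σ := by
    intro σ hσ
    obtain ⟨u, t, z, hu, ht, hz⟩ := (hpos σ hσ).exists_eigenvector_expansion ζ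
    refine ⟨_, ?_, hasDerivAt_re (hasDerivAt_quadForm_cfc hf hherm (hpos σ hσ)
      (H := fun ρ => Q * X * S σ + S σ * X * Q + ((ρ - σ : ℝ) : ℂ) • (Q * X * Q))
      (fun ρ => ?_) (by fun_prop) hu ht hz)⟩
    · have hnn := hK.sum_projection_nonneg hQ hQh ht (hz ▸ hQζ)
      set q : ι → ι → ℂ := fun i j => star (u i) ⬝ᵥ (Q *ᵥ u j) with hq
      have hσ' : (σ : ℂ) ≠ 0 := by exact_mod_cast hσ.ne'
      -- `σ` times the derivative of `S X S` is the anticommutator of `Q` and `S X S`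
      have hH : ∀ i j, (σ : ℂ) * (star (u i) ⬝ᵥ ((Q * X * S σ + S σ * X * Q +
          ((σ - σ : ℝ) : ℂ) • (Q * X * Q)) *ᵥ u j)) = ((t i + t j : ℝ) : ℂ) * q i j := by
        intro i j
        have e : (σ : ℂ) • (Q * X * S σ + S σ * X * Q + ((σ - σ : ℝ) : ℂ) • (Q * X * Q)) =
            Q * A σ + A σ * Q := by
          simp only [hA]
          have e1 : Q * (S σ * X * S σ) = (σ : ℂ) • (Q * X * S σ) := by
            rw [← Matrix.mul_assoc, ← Matrix.mul_assoc, hQS, Matrix.smul_mul, Matrix.smul_mul]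
          have e2 : S σ * X * S σ * Q = (σ : ℂ) • (S σ * X * Q) := by
            rw [Matrix.mul_assoc _ _ Q, hSQ, Matrix.mul_smul]
          rw [e1, e2, sub_self, Complex.ofReal_zero, zero_smul, add_zero, smul_add]
        have hr : star (u i) ᵥ* A σ = (t i : ℂ) • star (u i) := by
          have := congrArg star (hu i)
          rw [star_mulVec, (hherm σ).eq] at this
          rw [this]; ext; simp
        rw [← smul_eq_mul, ← dotProduct_smul, ← smul_mulVec, e, add_mulVec, dotProduct_add,
          ← mulVec_mulVec, hu, mulVec_smul, dotProduct_smul, ← mulVec_mulVec,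
          dotProduct_mulVec _ (A σ), hr, smul_dotProduct]
        simp only [hq, smul_eq_mul]
        push_cast; ring
      -- these two sums remove the terms `f(tᵢ)` and `f(tⱼ)`
      have hz1 : ∀ i, ∑ j, z j * q i j = 0 := fun i => by
        have := congrArg (star (u i) ⬝ᵥ ·) (hz ▸ hQζ)
        simpa [mulVec_sum, dotProduct_sum, mulVec_smul] using this
      have hz2 : ∀ j, ∑ i, star (z i) * q i j = 0 := fun j => by
        have h1 : star ζ ⬝ᵥ (Q *ᵥ u j) = 0 := by
          have := congrArg star hQζ
          rw [star_mulVec, hQh] at this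
          rw [dotProduct_mulVec, this]; simp
        rw [hz] at h1
        simpa [sum_dotProduct, smul_dotProduct] using h1
      have hkey : (σ : ℂ) * (∑ i, ∑ j, star (z i) * z j * (divDiff f (t i) (t j) : ℂ) *
          (star (u i) ⬝ᵥ ((Q * X * S σ + S σ * X * Q +
            ((σ - σ : ℝ) : ℂ) • (Q * X * Q)) *ᵥ u j))) =
          2 * ∑ i, ∑ j, star (z i) * z j * (divDiff (fun r => r * f r) (t i) (t j) : ℂ) *
            q i j := by
        have e1 : ∑ i, ∑ j, star (z i) * z j * (f (t i) : ℂ) * q i j = 0 := by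
          refine Finset.sum_eq_zero fun i _ => ?_
          rw [← mul_zero (star (z i) * (f (t i) : ℂ)), ← hz1 i, Finset.mul_sum]
          exact Finset.sum_congr rfl fun j _ => by ring
        have e2 : ∑ i, ∑ j, star (z i) * z j * (f (t j) : ℂ) * q i j = 0 := by
          rw [Finset.sum_comm]
          refine Finset.sum_eq_zero fun j _ => ?_
          rw [← mul_zero (z j * (f (t j) : ℂ)), ← hz2 j, Finset.mul_sum]
          exact Finset.sum_congr rfl fun i _ => by ring
        rw [← add_zero ((σ : ℂ) * _), ← add_zero ((σ : ℂ) * _ + 0)]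
        nth_rewrite 1 [← e1]
        nth_rewrite 1 [← e2]
        simp only [Finset.mul_sum, ← Finset.sum_add_distrib]
        refine Finset.sum_congr rfl fun i _ => Finset.sum_congr rfl fun j _ => ?_
        have h3 : (2 : ℂ) * (divDiff (fun r => r * f r) (t i) (t j) : ℂ) =
            ((t i + t j : ℝ) : ℂ) * (divDiff f (t i) (t j) : ℂ) + f (t i) + f (t j) := by
          exact_mod_cast divDiff_id_mul hf (ht i)
        linear_combination (star (z i) * z j * (divDiff f (t i) (t j) : ℂ)) * hH i j -
          star (z i) * z j * q i j * h3
      have hre := congrArg Complex.re hkey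
      rw [Complex.re_ofReal_mul, Complex.mul_re] at hre
      simp only [Complex.re_ofNat, Complex.im_ofNat, zero_mul, sub_zero] at hre
      have : 0 ≤ σ * _ := hre ▸ (mul_nonneg zero_le_two hnn)
      exact nonneg_of_mul_nonneg_right this hσ
    · have e : S ρ = S σ + ((ρ - σ : ℝ) : ℂ) • Q := by
        simp only [hS, Complex.ofReal_sub, sub_smul]; abel
      simp only [hA]
      rw [e]
      simp only [Matrix.add_mul, Matrix.mul_add, Matrix.smul_mul, Matrix.mul_smul, smul_add]
      abel
  have hmono : MonotoneOn (fun σ => (star ζ ⬝ᵥ (cfc f (A σ) *ᵥ ζ)).re) (Set.Ioi 0) := by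
    refine monotoneOn_of_deriv_nonneg (convex_Ioi 0) (fun σ hσ => ?_) (fun σ hσ => ?_)
      fun σ hσ => ?_
    · obtain ⟨d, -, h⟩ := hderiv σ hσ
      exact h.continuousAt.continuousWithinAt
    · rw [interior_Ioi] at hσ
      obtain ⟨d, -, h⟩ := hderiv σ hσ
      exact h.differentiableAt.differentiableWithinAt
    · rw [interior_Ioi] at hσ
      obtain ⟨d, hd, h⟩ := hderiv σ hσ
      rw [h.deriv]; exact hd
  have hVinj : Function.Injective V.mulVec := mulVec_injective_of_mul_eq_one hV
  have hS0 : S 0 = V * Vᴴ := by simp [hS, hP]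
  have hlim : Tendsto A (𝓝[>] 0) (𝓝 (V * (Vᴴ * X * V) * Vᴴ)) := by
    have hc : Continuous A := by fun_prop
    have e : A 0 = V * (Vᴴ * X * V) * Vᴴ := by
      simp only [hA, hS0, Matrix.mul_assoc]
    rw [← e]
    exact (hc.tendsto 0).mono_left nhdsWithin_le_nhds
  have h1 : A 1 = X := by simp [hA, hS]
  rw [← star_mulVec_dotProduct_mulVec]
  refine quadForm_cfc_le_of_tendsto hf.continuousOn hδ hfδ hV
    (hX.conjTranspose_mul_mul_same hVinj) hlim ?_ v ?_
  · filter_upwards [self_mem_nhdsWithin] with σ hσ using hpos σ hσ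
  · filter_upwards [Ioc_mem_nhdsGT zero_lt_one] with σ hσ
    have := hmono hσ.1 (Set.mem_Ioi.2 zero_lt_one) hσ.2
    simp only [h1] at this
    exact this

end Compression

/-! ### Loewner matrices as kernels -/

/-- Fewer points: pad the points with `1` and the coefficients with `0`. -/
lemma IsCondPosKernel.of_embedding {ι κ : Type*} [Fintype ι] [Fintype κ] {K : ℝ → ℝ → ℝ}
    (hK : IsCondPosKernel K ι) (e : κ ↪ ι) : IsCondPosKernel K κ := by
  intro t ht x hx
  have ht' : ∀ i, 0 < Function.extend e t 1 i := fun i => by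
    by_cases h : ∃ a, e a = i
    · obtain ⟨a, rfl⟩ := h
      rw [e.injective.extend_apply]; exact ht a
    · rw [Function.extend_apply' _ _ _ h]; exact one_pos
  have h0 : ∀ i ∉ Set.range e, Function.extend e x 0 i = 0 := fun i hi => by
    rw [Function.extend_apply' _ _ _ hi]; rfl
  have h1 := hK _ ht' (Function.extend e x 0) (by
    rw [← hx]
    exact (Fintype.sum_of_injective e e.injective _ _ h0
      fun i => (e.injective.extend_apply _ _ _).symm).symm)
  convert h1 using 2
  refine Fintype.sum_of_injective e e.injective _ _ (fun i hi => by simp [h0 i hi]) fun i => ?_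
  refine Fintype.sum_of_injective e e.injective _ _ (fun j hj => by simp [h0 j hj]) fun j => ?_
  simp only [e.injective.extend_apply]

lemma sum_sum_star_mul_add_eq_zero {ι : Type*} [Fintype ι] {x : ι → ℂ} (hx : ∑ i, x i = 0)
    (a b : ι → ℂ) : ∑ i, ∑ j, star (x i) * x j * (a i + b j) = 0 := by
  have h1 : ∑ i, ∑ j, star (x i) * x j * a i = 0 := by
    refine Finset.sum_eq_zero fun i _ => ?_
    rw [← mul_zero (star (x i) * a i), ← hx, Finset.mul_sum]
    exact Finset.sum_congr rfl fun j _ => by ring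
  have h2 : ∑ i, ∑ j, star (x i) * x j * b j = 0 := by
    have hx' : ∑ i, star (x i) = 0 := by rw [← star_sum, hx, star_zero]
    rw [Finset.sum_comm]
    refine Finset.sum_eq_zero fun j _ => ?_
    rw [← mul_zero (x j * b j), ← hx', Finset.mul_sum]
    exact Finset.sum_congr rfl fun j _ => by ring
  simp only [mul_add, Finset.sum_add_distrib, h1, h2, add_zero]

lemma IsCondPosKernel.congr_add_const {ι : Type*} [Fintype ι] {K K' : ℝ → ℝ → ℝ} {c : ℝ}
    (hK : IsCondPosKernel K ι) (h : ∀ s t, 0 < s → 0 < t → K' s t = K s t + c) :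
    IsCondPosKernel K' ι := by
  intro t ht x hx
  have h1 := hK t ht x hx
  have h2 := sum_sum_star_mul_add_eq_zero hx (fun _ => (c : ℂ)) fun _ => 0
  convert h1 using 2
  rw [← add_zero (∑ i, ∑ j, star (x i) * x j * (K (t i) (t j) : ℂ)), ← h2]
  simp only [← Finset.sum_add_distrib]
  refine Finset.sum_congr rfl fun i _ => Finset.sum_congr rfl fun j _ => ?_
  rw [h _ _ (ht i) (ht j)]; push_cast; ring

lemma star_dotProduct_mulVec_eq_sum {ι : Type*} [Fintype ι] (M : Matrix ι ι ℂ) (x : ι → ℂ) :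
    star x ⬝ᵥ (M *ᵥ x) = ∑ i, ∑ j, star (x i) * x j * M i j := by
  simp only [dotProduct, mulVec, Finset.mul_sum, Pi.star_apply]
  exact Finset.sum_congr rfl fun i _ => Finset.sum_congr rfl fun j _ => by ring

lemma forall_condPosDef_loewnerMatrix_iff {f : ℝ → ℝ} {n : ℕ} :
    (∀ t : Fin n → ℝ, (∀ i, 0 < t i) → CondPosDef (loewnerMatrix f t)) ↔
      IsCondPosKernel (divDiff f) (Fin n) := by
  refine forall_congr' fun t => forall_congr' fun _ => ?_
  have h : (loewnerMatrix f t).IsHermitian := by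
    ext i j
    simp [loewnerMatrix, divDiff_comm f (t j)]
  simp only [CondPosDef, h, true_and, star_dotProduct_mulVec_eq_sum]
  rfl

lemma forall_condNegDef_loewnerMatrix_iff {f : ℝ → ℝ} {n : ℕ} :
    (∀ t : Fin n → ℝ, (∀ i, 0 < t i) → CondNegDef (loewnerMatrix f t)) ↔
      IsCondPosKernel (fun s t => -divDiff f s t) (Fin n) := by
  refine forall_congr' fun t => forall_congr' fun _ => ?_
  have h : (-loewnerMatrix f t).IsHermitian := by
    ext i j
    simp [loewnerMatrix, divDiff_comm f (t j)]
  simp only [CondNegDef, CondPosDef, h, true_and, star_dotProduct_mulVec_eq_sum,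
    Complex.ofReal_neg]
  rfl

/-! ### Convexity from the Loewner conditions -/

/-- Convexity of order `n` follows from Jensen's inequality for compressions from size `2n`: take
`X = diag(A, B)` and `V = (√l, √(1 - l))`. -/
theorem condA_of_compression {n : ℕ} {f : ℝ → ℝ}
    (h : ∀ X : Matrix (Fin n ⊕ Fin n) (Fin n ⊕ Fin n) ℂ, X.PosDef →
      ∀ V : Matrix (Fin n ⊕ Fin n) (Fin n) ℂ, Vᴴ * V = 1 → ∀ v : Fin n → ℂ,
      (star v ⬝ᵥ (cfc f (Vᴴ * X * V) *ᵥ v)).re ≤ (star v ⬝ᵥ ((Vᴴ * cfc f X * V) *ᵥ v)).re) :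
    CondA n f := by
  intro A B hA hB hAs hBs l hl0 hl1
  have hAp := posDef_iff_spectrum.2 ⟨hA, hAs⟩
  have hBp := posDef_iff_spectrum.2 ⟨hB, hBs⟩
  set X := fromBlocks A 0 0 B with hX
  have hXh : X.IsHermitian := IsHermitian.fromBlocks hA (by simp) hB
  have hXp : X.PosDef := by
    refine .of_dotProduct_mulVec_pos hXh fun x hx => ?_
    have hsum : star x ⬝ᵥ (X *ᵥ x) = star (x ∘ Sum.inl) ⬝ᵥ (A *ᵥ (x ∘ Sum.inl)) +
        star (x ∘ Sum.inr) ⬝ᵥ (B *ᵥ (x ∘ Sum.inr)) := by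
      rw [hX, fromBlocks_mulVec]
      simp [dotProduct, Fintype.sum_sum_type]
    rw [hsum]
    by_cases h1 : x ∘ Sum.inl = 0
    · have h2 : x ∘ Sum.inr ≠ 0 := fun h2 => hx (by
        ext i
        rcases i with i | i
        · exact congrFun h1 i
        · exact congrFun h2 i)
      exact add_pos_of_nonneg_of_pos (hAp.posSemidef.dotProduct_mulVec_nonneg _)
        (hBp.dotProduct_mulVec_pos h2)
    · exact add_pos_of_pos_of_nonneg (hAp.dotProduct_mulVec_pos h1)
        (hBp.posSemidef.dotProduct_mulVec_nonneg _)
  set E₁ : Matrix (Fin n ⊕ Fin n) (Fin n) ℂ := fromRows 1 0 with hE₁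
  set E₂ : Matrix (Fin n ⊕ Fin n) (Fin n) ℂ := fromRows 0 1 with hE₂
  have hX1 : cfc f X * E₁ = E₁ * cfc f A := cfc_mul_eq_mul_cfc hXh hA (by
    simp [hX, hE₁, fromBlocks_mul_fromRows, fromRows_mul]) f
  have hX2 : cfc f X * E₂ = E₂ * cfc f B := cfc_mul_eq_mul_cfc hXh hB (by
    simp [hX, hE₂, fromBlocks_mul_fromRows, fromRows_mul]) f
  have hX1' : X * E₁ = E₁ * A := by simp [hX, hE₁, fromBlocks_mul_fromRows, fromRows_mul]
  have hX2' : X * E₂ = E₂ * B := by simp [hX, hE₂, fromBlocks_mul_fromRows, fromRows_mul]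
  have h11 : E₁ᴴ * E₁ = 1 := by simp [hE₁, conjTranspose_fromRows_eq_fromCols_conjTranspose,
    fromCols_mul_fromRows]
  have h12 : E₁ᴴ * E₂ = 0 := by simp [hE₁, hE₂, conjTranspose_fromRows_eq_fromCols_conjTranspose,
    fromCols_mul_fromRows]
  have h21 : E₂ᴴ * E₁ = 0 := by simp [hE₁, hE₂, conjTranspose_fromRows_eq_fromCols_conjTranspose,
    fromCols_mul_fromRows]
  have h22 : E₂ᴴ * E₂ = 1 := by simp [hE₂, conjTranspose_fromRows_eq_fromCols_conjTranspose,
    fromCols_mul_fromRows]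
  set V : Matrix (Fin n ⊕ Fin n) (Fin n) ℂ := √l • E₁ + √(1 - l) • E₂ with hV
  have hl : √l * √l = l := Real.mul_self_sqrt hl0.le
  have hl' : √(1 - l) * √(1 - l) = 1 - l := Real.mul_self_sqrt (by linarith)
  have hcomp : ∀ (M : Matrix (Fin n ⊕ Fin n) (Fin n ⊕ Fin n) ℂ) (A' B' : Matrix (Fin n) (Fin n) ℂ),
      M * E₁ = E₁ * A' → M * E₂ = E₂ * B' → Vᴴ * M * V = l • A' + (1 - l) • B' := by
    intro M A' B' h1 h2
    rw [Matrix.mul_assoc, hV, Matrix.mul_add, Matrix.mul_smul, Matrix.mul_smul, h1, h2,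
      conjTranspose_add, conjTranspose_smul, conjTranspose_smul, Matrix.add_mul, Matrix.mul_add,
      Matrix.mul_add]
    simp only [Matrix.smul_mul, Matrix.mul_smul, ← Matrix.mul_assoc, h11, h12, h21, h22,
      Matrix.one_mul, Matrix.zero_mul, smul_zero, add_zero, zero_add, star_trivial, smul_smul, hl,
      hl']
  have hVV : Vᴴ * V = 1 := by
    have := hcomp 1 1 1 (by simp) (by simp)
    rw [Matrix.mul_one] at this
    rw [this, ← add_smul]; simp
  refine posSemidef_of_re_nonneg ?_ fun v => ?_
  · exact (((isHermitian_cfc f A).smul (IsSelfAdjoint.all l)).add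
      ((isHermitian_cfc f B).smul (IsSelfAdjoint.all (1 - l)))).sub (isHermitian_cfc f _)
  · have := h X hXp V hVV v
    rw [hcomp X A B hX1' hX2', hcomp _ _ _ hX1 hX2] at this
    rw [sub_mulVec, dotProduct_sub, Complex.sub_re]
    linarith

/-- With `c` a lower bound of `f(t)/t` near `∞`, the function `f(t) - ct` is nonnegative there; its
Loewner matrices differ by a constant from those of `f`. -/
theorem CondB.condA {f : ℝ → ℝ} (hf : DifferentiableOn ℝ f (Set.Ioi 0)) {m n : ℕ}
    (hmn : 2 * n ≤ m) (h : CondB m f) : CondA n f := by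
  obtain ⟨hlim, hL⟩ := h
  have hK : IsCondPosKernel (fun s t => -divDiff f s t) (Fin n ⊕ Fin n) :=
    (forall_condNegDef_loewnerMatrix_iff.1 hL).of_embedding
      (finSumFinEquiv.toEmbedding.trans (Fin.castLEEmb (by omega)))
  obtain ⟨c, -, hc⟩ := EReal.lt_iff_exists_real_btwn.1 hlim
  have hev := eventually_lt_of_lt_liminf hc
  obtain ⟨M, hM⟩ := eventually_atTop.1 hev
  refine condA_of_compression fun X hX V hV v => ?_
  have hg : DifferentiableOn ℝ (fun t => f t - c * t) (Set.Ioi 0) :=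
    hf.sub (differentiableOn_id.const_mul c)
  have hgK : IsCondPosKernel (fun s t => -divDiff (fun r => f r - c * r) s t) (Fin n ⊕ Fin n) := by
    refine hK.congr_add_const (c := c) fun s t hs ht => ?_
    unfold divDiff
    split_ifs with hst
    · have h1 := (hf.differentiableAt (Ioi_mem_nhds hs)).hasDerivAt
      have h2 := (h1.fun_sub ((hasDerivAt_id' s).const_mul c)).deriv
      rw [h2]; ring
    · have : s - t ≠ 0 := sub_ne_zero.2 hst
      beta_reduce
      field_simp; ring
  have hgM : ∀ t, max M 1 < t → 0 ≤ f t - c * t := fun t ht => by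
    have ht0 : 0 < t := lt_of_lt_of_le one_pos ((le_max_right _ _).trans ht.le)
    have h1 : c < f t / t := by exact_mod_cast hM t ((le_max_left _ _).trans ht.le)
    linarith [(lt_div_iff₀ ht0).1 h1]
  have hcfc : ∀ {κ : Type} [Fintype κ] [DecidableEq κ] {A : Matrix κ κ ℂ}, A.IsHermitian →
      cfc (fun t => f t - c * t) A = cfc f A - c • A := fun {κ} _ _ {A} hA => by
    have hcont := fun g : ℝ → ℝ => continuousOn_spectrum_matrix (A := A) g
    rw [cfc_sub _ _ A (hcont _) (hcont _), cfc_const_mul_id c A hA.isSelfAdjoint]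
  have key := quadForm_cfc_compression_le_of_atTop hg hgK (lt_max_of_lt_right one_pos) hgM hX hV v
  rw [hcfc (isHermitian_conjTranspose_mul_mul V hX.1), hcfc hX.1, Matrix.mul_sub, Matrix.sub_mul,
    sub_mulVec, sub_mulVec, dotProduct_sub, dotProduct_sub, Complex.sub_re, Complex.sub_re,
    Matrix.mul_smul, Matrix.smul_mul] at key
  linarith

/-- If the mean of `g'` at the ends of an interval is at least its average, then
`(g(v) - g(1) - g'(1)(v - 1)) / (v - 1)²` is monotone on `(0, 1)`. So `g` has a limit at `0` in
`[-∞, ∞)`, and a lower bound for its upper limit is a lower bound for its limit. -/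
lemma eventually_neg_lt_of_deriv_add_deriv_ge {g : ℝ → ℝ} (hg : DifferentiableOn ℝ g (Set.Ioi 0))
    (h2 : ∀ u v, 0 < u → u < v → 2 * (g u - g v) / (u - v) ≤ deriv g u + deriv g v)
    (hfr : ∀ ε > 0, ∃ᶠ t in 𝓝[>] (0 : ℝ), -ε < g t) {ε : ℝ} (hε : 0 < ε) :
    ∀ᶠ t in 𝓝[>] (0 : ℝ), -ε < g t := by
  set ψ : ℝ → ℝ := fun v => (g v - g 1 - deriv g 1 * (v - 1)) / (v - 1) ^ 2 with hψ
  have hder : ∀ v ∈ Set.Ioo (0 : ℝ) 1, HasDerivAt ψ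
      ((deriv g v + deriv g 1 - 2 * (g v - g 1) / (v - 1)) / (v - 1) ^ 2) v := by
    intro v hv
    have hv1 : v - 1 ≠ 0 := by linarith [hv.2]
    have h1 := (hg.differentiableAt (Ioi_mem_nhds hv.1)).hasDerivAt
    have h3 := (((h1.sub_const (g 1)).fun_sub
      (((hasDerivAt_id' v).sub_const 1).const_mul (deriv g 1)))).fun_div
      (((hasDerivAt_id' v).sub_const 1).fun_pow 2) (pow_ne_zero 2 hv1)
    refine h3.congr_deriv ?_
    field_simp
    push_cast
    ring
  have hmono : MonotoneOn ψ (Set.Ioo 0 1) := by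
    refine monotoneOn_of_deriv_nonneg (convex_Ioo 0 1)
      (fun v hv => (hder v hv).continuousAt.continuousWithinAt)
      (fun v hv => ?_) (fun v hv => ?_) <;> rw [interior_Ioo] at hv
    · exact (hder v hv).differentiableAt.differentiableWithinAt
    · rw [(hder v hv).deriv]
      exact div_nonneg (sub_nonneg.2 (h2 v 1 hv.1 hv.2)) (sq_nonneg _)
  have hlow : ∀ v ∈ Set.Ioo (0 : ℝ) 1, deriv g 1 - g 1 ≤ ψ v := by
    intro v hv
    refine le_of_forall_pos_le_add fun η hη => ?_
    have hc : Tendsto (fun w : ℝ => (-η / 2 - g 1 - deriv g 1 * (w - 1)) / (w - 1) ^ 2) (𝓝[>] 0)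
        (𝓝 ((-η / 2 - g 1 - deriv g 1 * (0 - 1)) / (0 - 1) ^ 2)) := by
      refine tendsto_nhdsWithin_of_tendsto_nhds (ContinuousAt.tendsto ?_)
      fun_prop (disch := norm_num)
    have hev := hc.eventually (lt_mem_nhds (a := deriv g 1 - g 1 - η) (by norm_num; linarith))
    -- compare with a point `w < v` where `g` is almost nonnegative
    obtain ⟨w, hw1, hw2, hw3⟩ := ((hfr (η / 2) (by positivity)).and_eventually
      (hev.and (Ioo_mem_nhdsGT hv.1))).exists
    have hw : w ∈ Set.Ioo (0 : ℝ) 1 := ⟨hw3.1, hw3.2.trans hv.2⟩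
    have hsq : 0 < (w - 1) ^ 2 := by nlinarith [hw.2]
    have h4 : (-η / 2 - g 1 - deriv g 1 * (w - 1)) / (w - 1) ^ 2 ≤ ψ w := by
      rw [hψ]; simp only; gcongr; linarith
    linarith [hmono hw hv hw3.2.le]
  have hc : Tendsto (fun v : ℝ => g 1 + deriv g 1 * (v - 1) + (deriv g 1 - g 1) * (v - 1) ^ 2)
      (𝓝[>] 0) (𝓝 (g 1 + deriv g 1 * (0 - 1) + (deriv g 1 - g 1) * (0 - 1) ^ 2)) := by
    refine tendsto_nhdsWithin_of_tendsto_nhds (ContinuousAt.tendsto ?_)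
    fun_prop
  filter_upwards [hc.eventually (lt_mem_nhds (a := -ε) (by ring_nf; linarith)),
    Ioo_mem_nhdsGT one_pos] with v hv1 hv2
  have hsq : 0 < (v - 1) ^ 2 := by nlinarith [hv2.2]
  have := (le_div_iff₀ hsq).1 (hlow v hv2)
  linarith

lemma IsCondPosKernel.two_mul_le {K : ℝ → ℝ → ℝ} (hK : IsCondPosKernel K (Fin 2)) {u v : ℝ}
    (hu : 0 < u) (hv : 0 < v) : K u v + K v u ≤ K u u + K v v := by
  have := hK ![u, v] (by intro i; fin_cases i <;> simpa) ![1, -1] (by simp)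
  simp [Fin.sum_univ_two] at this
  linarith

/-- Adding `ε/t` to `f` makes it nonnegative near `0` and adds a constant to `t f(t)`, which leaves
the Loewner matrices of `t f(t)` unchanged; then `ε → 0`. -/
theorem CondC.condA {f : ℝ → ℝ} (hf : DifferentiableOn ℝ f (Set.Ioi 0)) {m n : ℕ}
    (hmn : 2 * n ≤ m) (hm : 2 ≤ m) (h : CondC m f) : CondA n f := by
  obtain ⟨hlim, hL⟩ := h
  have hK0 := forall_condPosDef_loewnerMatrix_iff.1 hL
  have hK : IsCondPosKernel (divDiff fun r => r * f r) (Fin n ⊕ Fin n) :=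
    hK0.of_embedding (finSumFinEquiv.toEmbedding.trans (Fin.castLEEmb (by omega)))
  have hK2 : IsCondPosKernel (divDiff fun r => r * f r) (Fin 2) :=
    hK0.of_embedding (Fin.castLEEmb hm)
  have hg : DifferentiableOn ℝ (fun r => r * f r) (Set.Ioi 0) := differentiableOn_id.mul hf
  have hev : ∀ ε > 0, ∀ᶠ t in 𝓝[>] (0 : ℝ), -ε < t * f t := fun ε hε => by
    refine eventually_neg_lt_of_deriv_add_deriv_ge hg (fun u v hu huv => ?_) (fun η hη => ?_) hε
    · have h1 := hK2.two_mul_le hu (hu.trans huv)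
      rw [divDiff_comm _ v u] at h1
      simp only [divDiff, huv.ne, if_true, if_false] at h1
      rw [mul_div_assoc]; linarith
    · have h1 : ((-η : ℝ) : EReal) < limsup (fun t : ℝ => ((t * f t : ℝ) : EReal)) (𝓝[>] 0) :=
        lt_of_lt_of_le (by exact_mod_cast neg_neg_of_pos hη) hlim
      exact (frequently_lt_of_lt_limsup (by isBoundedDefault) h1).mono
        fun t ht => by exact_mod_cast ht
  refine condA_of_compression fun X hX V hV v => ?_
  have hcfc : ∀ {κ : Type} [Fintype κ] [DecidableEq κ] (A : Matrix κ κ ℂ) (ε : ℝ),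
      cfc (fun t => f t + ε * t⁻¹) A = cfc f A + ε • cfc (fun t : ℝ => t⁻¹) A :=
    fun {κ} _ _ A ε => by
    have hcont := fun g : ℝ → ℝ => continuousOn_spectrum_matrix (A := A) g
    rw [cfc_add _ _ _ (hcont _) (hcont _), cfc_const_mul _ _ _ (hcont _)]
  have key : ∀ ε > 0,
      (star v ⬝ᵥ (cfc f (Vᴴ * X * V) *ᵥ v)).re +
        ε * (star v ⬝ᵥ (cfc (fun t : ℝ => t⁻¹) (Vᴴ * X * V) *ᵥ v)).re ≤
      (star v ⬝ᵥ ((Vᴴ * cfc f X * V) *ᵥ v)).re +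
        ε * (star v ⬝ᵥ ((Vᴴ * cfc (fun t : ℝ => t⁻¹) X * V) *ᵥ v)).re := by
    intro ε hε
    obtain ⟨δ, hδ, hδf⟩ := mem_nhdsGT_iff_exists_Ioo_subset.1 (hev ε hε)
    have hh : DifferentiableOn ℝ (fun t => f t + ε * t⁻¹) (Set.Ioi 0) :=
      hf.add ((differentiableOn_id.inv fun x hx => ne_of_gt hx).const_mul ε)
    have heq : ∀ r, 0 < r → r * (f r + ε * r⁻¹) = r * f r + ε := fun r hr => by
      field_simp
    have hhK : IsCondPosKernel (divDiff fun r => r * (f r + ε * r⁻¹)) (Fin n ⊕ Fin n) := by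
      refine hK.congr_add_const (c := 0) fun s t hs ht => ?_
      rw [add_zero]
      unfold divDiff
      beta_reduce
      rw [heq s hs, heq t ht, add_sub_add_right_eq_sub]
      have : (fun r => r * (f r + ε * r⁻¹)) =ᶠ[𝓝 s] fun r => r * f r + ε := by
        filter_upwards [Ioi_mem_nhds hs] with r hr using heq r hr
      rw [this.deriv_eq, deriv_add_const]
    have h1 := quadForm_cfc_compression_le_of_zero hh hhK (Set.mem_Ioi.1 hδ) (fun t ht0 htδ => by
      have h2 : -ε < t * f t := hδf ⟨ht0, htδ⟩
      have h3 : 0 ≤ t * (f t + ε * t⁻¹) := by rw [heq t ht0]; linarith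
      exact nonneg_of_mul_nonneg_right h3 ht0) hX hV v
    rw [hcfc, hcfc, Matrix.mul_add, Matrix.add_mul, add_mulVec, add_mulVec, dotProduct_add,
      dotProduct_add, Complex.add_re, Complex.add_re, Matrix.mul_smul, Matrix.smul_mul,
      smul_mulVec, smul_mulVec, dotProduct_smul, dotProduct_smul, Complex.smul_re,
      Complex.smul_re] at h1
    exact h1
  have hc : ∀ a b : ℝ, Tendsto (fun ε => a + ε * b) (𝓝[>] 0) (𝓝 a) := fun a b => by
    have h1 : Continuous fun ε => a + ε * b := by fun_prop
    have h2 := (h1.tendsto 0).mono_left (nhdsWithin_le_nhds (s := Set.Ioi 0))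
    simpa using h2
  exact le_of_tendsto_of_tendsto (hc _ _) (hc _ _)
    (eventually_nhdsWithin_of_forall fun ε hε => key ε hε)

/-! ### The Loewner conditions from convexity -/

/-- Jensen's inequality for a compression of a matrix of the same order `m` as the convexity of `f`:
convexity is applied to `D` and its conjugate by the reflection `R = 2VV* - 1`, whose mean `M`
satisfies `M V = V (V* D V)`. -/
theorem CondA.quadForm_compression_le {κ : Type*} [Fintype κ] [DecidableEq κ] {m : ℕ} {f : ℝ → ℝ}
    (h : CondA m f) {D : Matrix (Fin m) (Fin m) ℂ} (hD : D.PosDef) {V : Matrix (Fin m) κ ℂ}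
    (hV : Vᴴ * V = 1) (v : κ → ℂ) :
    (star v ⬝ᵥ (cfc f (Vᴴ * D * V) *ᵥ v)).re ≤ (star v ⬝ᵥ ((Vᴴ * cfc f D * V) *ᵥ v)).re := by
  set R := (2 : ℂ) • (V * Vᴴ) - 1 with hR
  have hRh : Rᴴ = R := by simp [hR]
  have hRV : R * V = V := by
    rw [hR, Matrix.sub_mul, Matrix.smul_mul, Matrix.mul_assoc, hV, Matrix.mul_one, Matrix.one_mul]
    module
  have hVR : Vᴴ * R = Vᴴ := by
    have := congrArg conjTranspose hRV
    rwa [conjTranspose_mul, hRh] at this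
  have hRR : R * R = 1 := by
    conv_lhs => enter [2]; rw [hR]
    rw [Matrix.mul_sub, Matrix.mul_smul, ← Matrix.mul_assoc, hRV, Matrix.mul_one, hR]
    abel
  have hRDp : (R * D * R).PosDef := by
    have := hD.conjTranspose_mul_mul_same (mulVec_injective_of_mul_eq_one hRR)
    rwa [hRh] at this
  have hfR : cfc f (R * D * R) = R * cfc f D * R := by
    have h1 : cfc f (R * D * R) * R = R * cfc f D :=
      cfc_mul_eq_mul_cfc hRDp.1 hD.1 (by rw [Matrix.mul_assoc, hRR, Matrix.mul_one]) f
    rw [← h1, Matrix.mul_assoc _ R R, hRR, Matrix.mul_one]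
  have hconv := h D (R * D * R) hD.1 hRDp.1 (posDef_iff_spectrum.1 hD).2
    (posDef_iff_spectrum.1 hRDp).2 (1 / 2) (by norm_num) (by norm_num)
  set M := (1 / 2 : ℝ) • D + (1 - 1 / 2 : ℝ) • (R * D * R) with hM
  have hMh : M.IsHermitian :=
    (hD.1.smul (IsSelfAdjoint.all _)).add (hRDp.1.smul (IsSelfAdjoint.all _))
  have hMV : M * V = V * (Vᴴ * D * V) := by
    rw [hM, Matrix.add_mul, Matrix.smul_mul, Matrix.smul_mul, Matrix.mul_assoc _ R V, hRV,
      Matrix.mul_assoc R, hR, Matrix.sub_mul, Matrix.one_mul, Matrix.smul_mul]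
    simp only [Matrix.mul_assoc]
    module
  have hfM : cfc f M * V = V * cfc f (Vᴴ * D * V) :=
    cfc_mul_eq_mul_cfc hMh (isHermitian_conjTranspose_mul_mul V hD.1) hMV f
  have h1 := re_quadForm_nonneg hconv (V *ᵥ v)
  have h2 : Vᴴ * ((1 / 2 : ℝ) • cfc f D + (1 - 1 / 2 : ℝ) • cfc f (R * D * R) - cfc f M) * V =
      Vᴴ * cfc f D * V - cfc f (Vᴴ * D * V) := by
    have e1 : Vᴴ * cfc f M * V = cfc f (Vᴴ * D * V) := by
      rw [Matrix.mul_assoc, hfM, ← Matrix.mul_assoc, hV, Matrix.one_mul]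
    have e2 : Vᴴ * (R * cfc f D * R) * V = Vᴴ * cfc f D * V := by
      rw [Matrix.mul_assoc, Matrix.mul_assoc _ R V, hRV, Matrix.mul_assoc R, ← Matrix.mul_assoc,
        hVR, Matrix.mul_assoc]
    rw [hfR, Matrix.mul_sub, Matrix.sub_mul, e1, Matrix.mul_add, Matrix.add_mul, Matrix.mul_smul,
      Matrix.mul_smul, Matrix.smul_mul, Matrix.smul_mul, e2]
    module
  rw [star_mulVec_dotProduct_mulVec, h2, sub_mulVec, dotProduct_sub, Complex.sub_re] at h1
  linarith

lemma cfc_diagonal {ι : Type*} [Fintype ι] [DecidableEq ι] (f : ℝ → ℝ) (d : ι → ℝ) :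
    cfc f (diagonal fun i => (d i : ℂ)) = diagonal fun i => (f (d i) : ℂ) := by
  have hh : (diagonal fun i => (d i : ℂ)).IsHermitian :=
    isHermitian_diagonal_of_self_adjoint _ (by ext; simp)
  ext i j
  have h1 := cfc_mulVec_eq hh (u := Pi.single j 1) (t := d j) (by
    rw [diagonal_mulVec_single]; ext k; simp [Pi.single_apply]) f
  have := congrFun h1 i
  rw [mulVec_single_one] at this
  rw [← Matrix.col_apply (cfc f _), this]
  by_cases hij : i = j
  · subst hij; simp
  · simp [hij]

lemma nonneg_of_hasDerivAt_of_nonneg {φ : ℝ → ℝ} {d : ℝ} (h : HasDerivAt φ d 0) (h0 : φ 0 = 0)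
    (hpos : ∀ u, 0 < u → u < 1 → 0 ≤ φ u) : 0 ≤ d := by
  have h1 : Tendsto (slope φ 0) (𝓝[>] 0) (𝓝 d) :=
    (hasDerivAt_iff_tendsto_slope.1 h).mono_left
      (nhdsWithin_mono 0 fun x (hx : (0 : ℝ) < x) => hx.ne')
  refine ge_of_tendsto h1 ?_
  filter_upwards [Ioo_mem_nhdsGT one_pos] with u hu
  rw [slope_def_field, h0, sub_zero, sub_zero]
  exact div_nonneg (hpos u hu.1 hu.2) hu.1.le

/-- The isometry from `ℂⁿ` to `ℂ × ℂⁿ` which rotates the normalized all-ones vector `e` of `ℂⁿ`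
towards the first coordinate by an angle `θ` with `cos θ = 1 - u` and fixes the orthogonal
complement of `e`. It is parametrized by `u` rather than `θ` so that compressions by it are polynomial in `u`;
the matrix with all entries `n⁻¹` is the projection onto `e`. It is an isometry for `0 ≤ u ≤ 2`. -/
noncomputable def tiltedIsometry (n : ℕ) (u : ℝ) : Matrix (Fin (n + 1)) (Fin n) ℂ :=
  of (Fin.cons (fun _ => ((√(u * (2 - u) / n) : ℝ) : ℂ))
    (1 - (u : ℂ) • of fun _ _ => ((n : ℂ)⁻¹) : Matrix (Fin n) (Fin n) ℂ))

lemma tiltedIsometry_conj_diagonal {n : ℕ} {u : ℝ} (hu0 : 0 ≤ u) (hu2 : u ≤ 2) (s : ℂ)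
    (d : Fin n → ℂ) :
    (tiltedIsometry n u)ᴴ * diagonal (Fin.cons s d : Fin (n + 1) → ℂ) * tiltedIsometry n u =
      (1 - (u : ℂ) • of fun _ _ => ((n : ℂ)⁻¹)) * diagonal d *
        (1 - (u : ℂ) • of fun _ _ => ((n : ℂ)⁻¹)) +
      (s * (u * (2 - u))) • of fun _ _ => ((n : ℂ)⁻¹) := by
  set W : Matrix (Fin n) (Fin n) ℂ := 1 - (u : ℂ) • of fun _ _ => ((n : ℂ)⁻¹) with hW
  have hWh : Wᴴ = W := by
    ext i j
    simp [hW, Matrix.one_apply, eq_comm]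
  have hsq : ((√(u * (2 - u) / n) : ℝ) : ℂ) * ((√(u * (2 - u) / n) : ℝ) : ℂ) =
      u * (2 - u) * (n : ℂ)⁻¹ := by
    rw [← Complex.ofReal_mul, Real.mul_self_sqrt (div_nonneg (mul_nonneg hu0 (by linarith))
      (Nat.cast_nonneg n))]
    push_cast; ring
  have hrow0 : ∀ j, tiltedIsometry n u 0 j = ((√(u * (2 - u) / n) : ℝ) : ℂ) := fun _ => rfl
  have hrow : ∀ a j, tiltedIsometry n u (Fin.succ a) j = W a j := fun _ _ => rfl
  ext i j
  have e1 : ((tiltedIsometry n u)ᴴ * diagonal (Fin.cons s d : Fin (n + 1) → ℂ) *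
      tiltedIsometry n u) i j = s * (u * (2 - u) * (n : ℂ)⁻¹) +
        ∑ a, star (W a i) * d a * W a j := by
    rw [Matrix.mul_apply, Fin.sum_univ_succ]
    simp only [mul_diagonal, conjTranspose_apply, hrow0, hrow, Fin.cons_zero, Fin.cons_succ]
    congr 1
    rw [← hsq]
    simp only [RCLike.star_def, Complex.conj_ofReal]
    ring
  have e2 : (W * diagonal d * W) i j = ∑ a, star (W a i) * d a * W a j := by
    conv_lhs => enter [1, 1]; rw [← hWh]
    rw [Matrix.mul_apply]
    simp only [mul_diagonal, conjTranspose_apply]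
  rw [e1, Matrix.add_apply, e2]
  simp only [Matrix.smul_apply, of_apply, smul_eq_mul]
  ring

lemma tiltedIsometry_isometry {n : ℕ} (hn : 1 ≤ n) {u : ℝ} (hu0 : 0 ≤ u) (hu2 : u ≤ 2) :
    (tiltedIsometry n u)ᴴ * tiltedIsometry n u = 1 := by
  have h := tiltedIsometry_conj_diagonal (n := n) hu0 hu2 1 1
  have h1 : (Fin.cons 1 1 : Fin (n + 1) → ℂ) = 1 := by
    ext i; refine Fin.cases ?_ (fun i => ?_) i <;> simp
  rw [h1] at h
  simp only [Matrix.diagonal_one, Matrix.mul_one, Pi.one_def] at h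
  rw [h]
  have hn' : (n : ℂ) ≠ 0 := by exact_mod_cast (by omega : n ≠ 0)
  set p : Matrix (Fin n) (Fin n) ℂ := of fun _ _ => ((n : ℂ)⁻¹) with hp
  have hpp : p * p = p := by
    ext i j
    simp [hp, Matrix.mul_apply, hn']
  simp only [Matrix.mul_sub, Matrix.sub_mul, Matrix.one_mul, Matrix.mul_one, Matrix.smul_mul,
    Matrix.mul_smul, hpp]
  module

/-- The second-order form of `(n+1)`-convexity at `s, t₁, …, tₙ`. It is the derivative at `u = 0` of
`⟨x, (V* f(D) V - f(V* D V)) x⟩`, with `D = diag(s, t₁, …, tₙ)` and `V = tiltedIsometry n u`; this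
difference is nonnegative and vanishes at `u = 0`. -/
theorem CondA.sum_kernel_nonneg {n : ℕ} (hn : 1 ≤ n) {f : ℝ → ℝ} (h : CondA (n + 1) f)
    (hf : DifferentiableOn ℝ f (Set.Ioi 0)) {s : ℝ} (hs : 0 < s) {t : Fin n → ℝ}
    (ht : ∀ i, 0 < t i) (x : Fin n → ℂ) :
    0 ≤ (∑ i, ∑ j, star (x i) * x j *
      ((2 * f s - f (t i) - f (t j) -
        (2 * s - t i - t j) * divDiff f (t i) (t j) : ℝ) : ℂ)).re := by
  set p : Matrix (Fin n) (Fin n) ℂ := of fun _ _ => ((n : ℂ)⁻¹) with hp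
  have hph : pᴴ = p := by ext i j; simp [hp]
  set T : Matrix (Fin n) (Fin n) ℂ := diagonal fun i => (t i : ℂ) with hT
  set F : Matrix (Fin n) (Fin n) ℂ := diagonal fun i => (f (t i) : ℂ) with hF
  set B : ℝ → Matrix (Fin n) (Fin n) ℂ := fun u =>
    (1 - (u : ℂ) • p) * T * (1 - (u : ℂ) • p) + ((s : ℂ) * (u * (2 - u))) • p with hB
  have hTh : T.IsHermitian := isHermitian_diagonal_of_self_adjoint _ (by ext; simp)
  have hBh : ∀ u, (B u).IsHermitian := fun u => by
    simp only [hB, IsHermitian, conjTranspose_add, conjTranspose_mul, conjTranspose_sub,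
      conjTranspose_smul, conjTranspose_one, hph, hTh.eq, Matrix.mul_assoc]
    simp
  have hB0 : B 0 = T := by simp [hB]
  have hTp : T.PosDef := PosDef.diagonal fun i => by exact_mod_cast ht i
  have hcomp : ∀ u, 0 < u → u < 1 → (star x ⬝ᵥ (cfc f (B u) *ᵥ x)).re ≤
      (star x ⬝ᵥ (((1 - (u : ℂ) • p) * F * (1 - (u : ℂ) • p) +
        ((f s : ℂ) * (u * (2 - u))) • p) *ᵥ x)).re := by
    intro u hu0 hu1
    have hDp : (diagonal fun i => (((Fin.cons s t : Fin (n + 1) → ℝ) i : ℝ) : ℂ)).PosDef :=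
      PosDef.diagonal fun i => by
        refine Fin.cases ?_ (fun i => ?_) i
        · exact_mod_cast hs
        · exact_mod_cast ht i
    have h1 := h.quadForm_compression_le hDp
      (tiltedIsometry_isometry hn hu0.le (by linarith : u ≤ 2)) x
    rw [cfc_diagonal] at h1
    have e1 : (fun i => (((Fin.cons s t : Fin (n + 1) → ℝ) i : ℝ) : ℂ)) =
        Fin.cons (s : ℂ) fun i => (t i : ℂ) := by
      ext i; refine Fin.cases ?_ (fun i => ?_) i <;> simp
    have e2 : (fun i => ((f ((Fin.cons s t : Fin (n + 1) → ℝ) i) : ℝ) : ℂ)) =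
        Fin.cons (f s : ℂ) fun i => (f (t i) : ℂ) := by
      ext i; refine Fin.cases ?_ (fun i => ?_) i <;> simp
    rw [e1, e2, tiltedIsometry_conj_diagonal hu0.le (by linarith),
      tiltedIsometry_conj_diagonal hu0.le (by linarith)] at h1
    exact h1
  -- `B` is the compression of `D`, and `H 0` its derivative at `u = 0`
  set H : ℝ → Matrix (Fin n) (Fin n) ℂ := fun u =>
    (2 * s : ℂ) • p - p * T - T * p + (u : ℂ) • (p * T * p - (s : ℂ) • p) with hH
  have hBH : ∀ u, B u - B 0 = ((u - 0 : ℝ) : ℂ) • H u := fun u => by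
    rw [hB0, sub_zero]
    simp only [hB, hH, Matrix.mul_sub, Matrix.sub_mul, Matrix.one_mul, Matrix.mul_one,
      Matrix.smul_mul, Matrix.mul_smul]
    module
  have hd1 := hasDerivAt_quadForm_cfc hf hBh (hB0 ▸ hTp) hBH (by fun_prop)
    (u := fun k => Pi.single k (1 : ℂ)) (t := t) (z := x) (ζ := x)
    (fun k => by
      rw [hB0, hT, diagonal_mulVec_single]; ext j; simp [Pi.single_apply]) ht
    (by ext j; simp [Pi.single_apply])
  -- the compression of `f(D)` is the quadratic polynomial `F + u K₀ + u² K₁`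
  set K₀ := (2 * f s : ℂ) • p - p * F - F * p with hK₀
  set K₁ := p * F * p - (f s : ℂ) • p with hK₁
  have hψ : ∀ u : ℝ, star x ⬝ᵥ (((1 - (u : ℂ) • p) * F * (1 - (u : ℂ) • p) +
        ((f s : ℂ) * (u * (2 - u))) • p) *ᵥ x) =
      star x ⬝ᵥ (F *ᵥ x) + u * (star x ⬝ᵥ (K₀ *ᵥ x)) + u ^ 2 * (star x ⬝ᵥ (K₁ *ᵥ x)) := fun u => by
    have e : (1 - (u : ℂ) • p) * F * (1 - (u : ℂ) • p) + ((f s : ℂ) * (u * (2 - u))) • p =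
        F + (u : ℂ) • K₀ + ((u : ℂ) ^ 2) • K₁ := by
      simp only [hK₀, hK₁, Matrix.mul_sub, Matrix.sub_mul, Matrix.one_mul, Matrix.mul_one,
        Matrix.smul_mul, Matrix.mul_smul]
      module
    rw [e]
    simp only [add_mulVec, smul_mulVec, dotProduct_add, dotProduct_smul, smul_eq_mul]
  have hd2 : HasDerivAt (fun u : ℝ => star x ⬝ᵥ (F *ᵥ x) + u * (star x ⬝ᵥ (K₀ *ᵥ x)) +
      u ^ 2 * (star x ⬝ᵥ (K₁ *ᵥ x))) (star x ⬝ᵥ (K₀ *ᵥ x)) 0 := by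
    have h1 : HasDerivAt (fun u : ℝ => (u : ℂ)) 1 0 := Complex.ofRealCLM.hasDerivAt
    have h2 := ((h1.mul_const (star x ⬝ᵥ (K₀ *ᵥ x))).const_add (star x ⬝ᵥ (F *ᵥ x))).fun_add
      ((h1.fun_pow 2).mul_const (star x ⬝ᵥ (K₁ *ᵥ x)))
    exact h2.congr_deriv (by simp)
  have hmain := nonneg_of_hasDerivAt_of_nonneg (hasDerivAt_re (hd2.fun_sub hd1))
    (by rw [hB0, hT, cfc_diagonal]; simp [hF])
    (fun u hu0 hu1 => by
      rw [← hψ, Complex.sub_re]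
      exact sub_nonneg.2 (hcomp u hu0 hu1))
  have hval : (n : ℂ) * (star x ⬝ᵥ (K₀ *ᵥ x) - ∑ i, ∑ j, star (x i) * x j *
      (divDiff f (t i) (t j) : ℂ) *
        (star (Pi.single i (1 : ℂ)) ⬝ᵥ (H 0 *ᵥ Pi.single j (1 : ℂ)))) =
      ∑ i, ∑ j, star (x i) * x j * ((2 * f s - f (t i) - f (t j) -
        (2 * s - t i - t j) * divDiff f (t i) (t j) : ℝ) : ℂ) := by
    have hn' : (n : ℂ) ≠ 0 := by exact_mod_cast (by omega : n ≠ 0)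
    rw [star_dotProduct_mulVec_eq_sum, ← Finset.sum_sub_distrib, Finset.mul_sum]
    refine Finset.sum_congr rfl fun i _ => ?_
    rw [← Finset.sum_sub_distrib, Finset.mul_sum]
    refine Finset.sum_congr rfl fun j _ => ?_
    have e1 : star (Pi.single i (1 : ℂ)) ⬝ᵥ (H 0 *ᵥ Pi.single j (1 : ℂ)) = H 0 i j := by
      rw [← Pi.single_star, star_one, single_one_dotProduct, mulVec_single_one, Matrix.col_apply]
    rw [e1]
    simp only [hH, hK₀, hT, hF, hp, Complex.ofReal_zero, zero_smul, add_zero, Matrix.sub_apply,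
      Matrix.smul_apply, mul_diagonal, diagonal_mul, of_apply, smul_eq_mul]
    push_cast
    field_simp
    ring
  rw [← hval, ← Complex.ofReal_natCast, Complex.re_ofReal_mul]
  exact mul_nonneg (Nat.cast_nonneg n) hmain

lemma CondA.tangent_le {n : ℕ} (hn : 1 ≤ n) {f : ℝ → ℝ} (h : CondA (n + 1) f)
    (hf : DifferentiableOn ℝ f (Set.Ioi 0)) {s : ℝ} (hs : 0 < s) :
    f 1 + deriv f 1 * (s - 1) ≤ f s := by
  have := h.sum_kernel_nonneg hn hf hs (t := fun _ => 1) (fun _ => one_pos)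
    (Pi.single ⟨0, hn⟩ 1)
  simp only [Pi.single_apply, apply_ite star, star_one, star_zero, ite_mul, mul_ite, one_mul,
    zero_mul, mul_zero, Finset.sum_ite_eq', Finset.mem_univ, if_true, divDiff, mul_one] at this
  simp at this
  linarith

/-- On coefficients of sum zero, `CondA.sum_kernel_nonneg` is affine in `s`: its constant term and
its slope are the two Loewner forms, and both are nonnegative because `s > 0` is arbitrary. -/
theorem CondA.isCondPosKernel {n : ℕ} (hn : 1 ≤ n) {f : ℝ → ℝ} (h : CondA (n + 1) f)
    (hf : DifferentiableOn ℝ f (Set.Ioi 0)) :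
    IsCondPosKernel (fun s t => -divDiff f s t) (Fin n) ∧
      IsCondPosKernel (divDiff fun r => r * f r) (Fin n) := by
  have key : ∀ t : Fin n → ℝ, (∀ i, 0 < t i) → ∀ x : Fin n → ℂ, ∑ i, x i = 0 → ∀ s, 0 < s →
      0 ≤ (∑ i, ∑ j, star (x i) * x j * (divDiff (fun r => r * f r) (t i) (t j) : ℂ)).re +
        s * (∑ i, ∑ j, star (x i) * x j * ((-divDiff f (t i) (t j) : ℝ) : ℂ)).re := by
    intro t ht x hx s hs
    have h1 := h.sum_kernel_nonneg hn hf hs ht x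
    have h2 := sum_sum_star_mul_add_eq_zero hx (fun i => (2 * f s - 2 * f (t i) : ℂ))
      fun j => (-2 * f (t j) : ℂ)
    have h3 : ∑ i, ∑ j, star (x i) * x j * ((2 * f s - f (t i) - f (t j) -
        (2 * s - t i - t j) * divDiff f (t i) (t j) : ℝ) : ℂ) =
        2 * (∑ i, ∑ j, star (x i) * x j * (divDiff (fun r => r * f r) (t i) (t j) : ℂ) +
        s * ∑ i, ∑ j, star (x i) * x j * ((-divDiff f (t i) (t j) : ℝ) : ℂ)) := by
      rw [← sub_eq_zero, ← h2]
      simp only [mul_add, Finset.mul_sum, ← Finset.sum_add_distrib, ← Finset.sum_sub_distrib]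
      refine Finset.sum_congr rfl fun i _ => Finset.sum_congr rfl fun j _ => ?_
      have h4 : (2 : ℂ) * (divDiff (fun r => r * f r) (t i) (t j) : ℂ) =
          (t i + t j) * (divDiff f (t i) (t j) : ℂ) + f (t i) + f (t j) := by
        exact_mod_cast divDiff_id_mul hf (ht i)
      push_cast
      linear_combination -(star (x i) * x j) * h4
    rw [h3, Complex.mul_re, Complex.add_re, Complex.re_ofReal_mul] at h1
    simp only [Complex.re_ofNat, Complex.im_ofNat, zero_mul, sub_zero] at h1
    linarith
  constructor <;> intro t ht x hx
  · by_contra! hneg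
    set β := (∑ i, ∑ j, star (x i) * x j * ((-divDiff f (t i) (t j) : ℝ) : ℂ)).re
    set α := (∑ i, ∑ j, star (x i) * x j * (divDiff (fun r => r * f r) (t i) (t j) : ℂ)).re
    have h1 := key t ht x hx ((|α| + 1) / -β) (div_pos (by positivity) (by linarith))
    have h2 : (|α| + 1) / -β * β = -(|α| + 1) := by
      have := hneg.ne
      field_simp
    change 0 ≤ α + (|α| + 1) / -β * β at h1
    rw [h2] at h1
    linarith [le_abs_self α]
  · refine le_of_forall_pos_le_add fun ε hε => ?_
    set β := (∑ i, ∑ j, star (x i) * x j * ((-divDiff f (t i) (t j) : ℝ) : ℂ)).re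
    set α := (∑ i, ∑ j, star (x i) * x j * (divDiff (fun r => r * f r) (t i) (t j) : ℂ)).re
    have h1 := key t ht x hx (ε / (|β| + 1)) (by positivity)
    have h2 : ε / (|β| + 1) * β ≤ ε := by
      rw [div_mul_eq_mul_div, div_le_iff₀ (by positivity)]
      nlinarith [le_abs_self β]
    change 0 ≤ α + ε / (|β| + 1) * β at h1
    linarith

theorem CondA.condB {m n : ℕ} (hm : 1 ≤ m) (hnm : n ≤ m) {f : ℝ → ℝ} (h : CondA (m + 1) f)
    (hf : DifferentiableOn ℝ f (Set.Ioi 0)) : CondB n f := by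
  refine ⟨?_, forall_condNegDef_loewnerMatrix_iff.2
    ((h.isCondPosKernel hm hf).1.of_embedding (Fin.castLEEmb hnm))⟩
  have hb : ((deriv f 1 - |f 1 - deriv f 1| : ℝ) : EReal) ≤
      liminf (fun t : ℝ => ((f t / t : ℝ) : EReal)) atTop := by
    refine le_liminf_of_le (by isBoundedDefault) ?_
    filter_upwards [eventually_ge_atTop 1] with t ht
    have ht0 : 0 < t := by linarith
    refine EReal.coe_le_coe_iff.2 ((le_div_iff₀ ht0).2 ?_)
    have := h.tangent_le hm hf ht0
    nlinarith [neg_abs_le (f 1 - deriv f 1), abs_nonneg (f 1 - deriv f 1)]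
  exact lt_of_lt_of_le (EReal.bot_lt_coe _) hb

theorem CondA.condC {n : ℕ} (hn : 1 ≤ n) {f : ℝ → ℝ} (h : CondA (n + 1) f)
    (hf : DifferentiableOn ℝ f (Set.Ioi 0)) : CondC n f := by
  refine ⟨?_, forall_condPosDef_loewnerMatrix_iff.2 (h.isCondPosKernel hn hf).2⟩
  have hlim : Tendsto (fun t : ℝ => ((t * (f 1 + deriv f 1 * (t - 1)) : ℝ) : EReal)) (𝓝[>] 0)
      (𝓝 0) := by
    have h1 : Continuous fun t : ℝ => ((t * (f 1 + deriv f 1 * (t - 1)) : ℝ) : EReal) :=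
      continuous_coe_real_ereal.comp (by fun_prop)
    have h2 := (h1.tendsto 0).mono_left (nhdsWithin_le_nhds (s := Set.Ioi 0))
    simpa using h2
  rw [← hlim.limsup_eq]
  refine limsup_le_limsup ?_
  filter_upwards [self_mem_nhdsWithin] with t ht
  exact EReal.coe_le_coe_iff.2 (mul_le_mul_of_nonneg_left (h.tangent_le hn hf ht) (le_of_lt ht))

theorem theorem2p1 (f : ℝ → ℝ) (hf : ContDiffOn ℝ 1 f (Set.Ioi 0)) (n : ℕ) (hn : 1 ≤ n) :
    (CondA (2 * n + 1) f → CondB n f) ∧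
    (CondB (4 * n + 1) f → CondA n f) ∧
    (CondA (n + 1) f → CondC n f) ∧
    (CondC (2 * n + 1) f → CondA n f) := by
  have hd : DifferentiableOn ℝ f (Set.Ioi 0) := hf.differentiableOn one_ne_zero
  exact ⟨fun h => h.condB (by omega) (by omega) hd, fun h => h.condA hd (by omega),
    fun h => h.condC hn hd, fun h => h.condA hd (by omega) (by omega)⟩
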